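/- A (left) brace is an abelian group $(A,+)$ with a multiplication $\cdot$ such that, for all $a,b,c\in A$, $a\cdot(b+c)=a\cdot b+a\cdot c$, $(a\cdot b+a+b)\cdot c=a\cdot(b\cdot c)+a\cdot c+b\cdot c$, and the map $x\mapsto a\cdot x+x$ is bijective. Isomorphisms of braces are additive isomorphisms that preserve the multiplication. Write $\mathbb{Z}_n=\mathbb{Z}/n\mathbb{Z}$ and $C(n,2)=n(n-1)/2$. For primes $2<p<q$ define the following braces of order $p^2q$. - For $\omega,\mu\in\mathbb{Z}_q^\times$ with $\omega^p=\mu^p=1$, $T^{p,p,q}_{\omega,\mu}$ and $B^{p,p,q}_{\omega,\mu}$ are the group $\mathbb{Z}_p^2\oplus\mathbb{Z}_q$ with the multiplication $$((x_1,y_1),a_1)\cdot((x_2,y_2),a_2)=\big((0,0),\,(\omega^{x_1}\mu^{y_1}-1)a_2\big),$$ respectively $$((x_1,y_1),a_1)\cdot((x_2,y_2),a_2)=\big((y_1y_2,0),\,(\omega^{x_1-C(y_1,2)}\mu^{y_1}-1)a_2\big).$$ - For $\omega\in\mathbb{Z}_q^\times$ with $\omega^{p^2}=1$, $T^{p^2,q}_{\omega}$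 and $B^{p^2,q}_{\omega}$ are the group $\mathbb{Z}_{p^2}\oplus\mathbb{Z}_q$ with the multiplication $$(x_1,a_1)\cdot(x_2,a_2)=\big(0,\,(\omega^{x_1}-1)a_2\big),$$ respectively $$(x_1,a_1)\cdot(x_2,a_2)=\big(p\,x_1x_2,\,(\omega^{x_1-pC(x_1,2)}-1)a_2\big).$$ Theorem (fine classification). Let $p,q$ be primes with $2<p<q$. Fix a quadratic non-residue $\eta\in\mathbb{Z}_p^\times$; if $p\mid q-1$, fix a primitive $p$-th root of unity $\omega\in\mathbb{Z}_q^\times$; if $p^2\mid q-1$, fix a primitive $p^2$-th root of unity $\tilde\omega\in\mathbb{Z}_q^\times$. Then every brace of order $p^2q$ is isomorphic to exactly one member of the following list (whose members at different positions are regarded as different): - $T^{p,p,q}_{1,1}$, $T^{p^2,q}_{1}$, $B^{p,p,q}_{1,1}$, $B^{p^2,q}_{1}$; - if $p\mid q-1$, additionally $T^{p,p,q}_{\omega,1}$, $T^{p^2,q}_{\omega}$, the three braces $B^{p,p,q}_{1,\omega}$, $B^{p,p,q}_{\omega,1}$, $B^{p,p,q}_{\omega^{\eta},1}$, and the $p-1$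 braces $B^{p^2,q}_{\omega^i}$ $(i=1,\dots,p-1)$; - if $p^2\mid q-1$, additionally $T^{p^2,q}_{\tilde\omega}$ and the $p-1$ braces $B^{p^2,q}_{\tilde\omega^i}$ $(i=1,\dots,p-1)$. -/

import Mathlib

/-- A left brace structure on an abelian group `A`: a multiplication `mul` on `A` that satisfies
the three axioms (B1), (B2), (B3). -/
structure LeftBrace (A : Type*) [AddCommGroup A] where
  /-- the brace multiplication -/
  mul : A → A → A
  /-- (B1) `a ⬝ (b + c) = a ⬝ b + a ⬝ c` -/
  mul_add : ∀ a b c, mul a (b + c) = mul a b + mul a c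
  /-- (B2) `(a ⬝ b + a + b) ⬝ c = a ⬝ (b ⬝ c) + a ⬝ c + b ⬝ c` -/
  circ_mul : ∀ a b c, mul (mul a b + a + b) c = mul a (mul b c) + mul a c + mul b c
  /-- (B3) `x ↦ a ⬝ x + x` is bijective -/
  bijective : ∀ a, Function.Bijective fun x => mul a x + x

namespace LeftBrace

/-- An isomorphism of braces: an additive isomorphism that respects the multiplications. -/
structure Iso {A B : Type*} [AddCommGroup A] [AddCommGroup B]
    (S : LeftBrace A) (T : LeftBrace B) extends A ≃+ B where
  map_mul : ∀ a b, toFun (S.mul a b) = T.mul (toFun a) (toFun b)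

/-- The trivial brace on an abelian group: `a ⬝ b = 0`. -/
def trivial (A : Type*) [AddCommGroup A] : LeftBrace A where
  mul _ _ := 0
  mul_add := by simp
  circ_mul := by simp
  bijective a := by
    simp only [zero_add]
    exact Function.bijective_id

/-- The brace `B^{p,p}` on `ℤ_p²`: `(x₁, y₁) ⬝ (x₂, y₂) = (y₁ y₂, 0)`. -/
def Bpp (p : ℕ) : LeftBrace (ZMod p × ZMod p) where
  mul u v := (u.2 * v.2, 0)
  mul_add a b c := by ext <;> simp [_root_.mul_add]
  circ_mul a b c := by ext <;> simp [_root_.add_mul]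
  bijective a := by
    refine ⟨fun u v h => ?_, fun v => ⟨(v.1 - a.2 * v.2, v.2), by ext <;> simp⟩⟩
    simp only [Prod.ext_iff, Prod.fst_add, Prod.snd_add, zero_add] at h
    obtain ⟨h1, h2⟩ := h
    rw [h2] at h1
    exact Prod.ext (add_left_cancel h1) h2

theorem p_mul_p (p : ℕ) : (p : ZMod (p ^ 2)) * p = 0 := by
  rw [← Nat.cast_mul, ← pow_two, ZMod.natCast_self]

/-- The brace `B^{p²}` on `ℤ_{p²}`: `x₁ ⬝ x₂ = p x₁ x₂`. -/
def Bp2 (p : ℕ) : LeftBrace (ZMod (p ^ 2)) where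
  mul x y := p * x * y
  mul_add a b c := by ring
  circ_mul a b c := by linear_combination 0 * p_mul_p p
  bijective a := by
    have h := p_mul_p p
    refine ⟨fun x y hxy => ?_, fun y => ⟨(1 - p * a) * y, ?_⟩⟩
    · simp only at hxy
      linear_combination (1 - p * a) * hxy + a ^ 2 * (x - y) * h
    · simp only
      linear_combination (-a ^ 2 * y) * h

/-- The semidirect product `A ⋉ ℤ_q` of a brace `A` with `ℤ_q`, on which the adjoint group of `A`
acts through `χ : A → ℤ_q^×`, so that `a ∈ A` multiplies `c ∈ ℤ_q` to `(χ a - 1) c`: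
`(a₁, c₁) ⬝ (a₂, c₂) = (a₁ ⬝ a₂, (χ a₁ - 1) c₂)`.
The hypothesis on `χ` says that it is a homomorphism on the adjoint group. -/
def semidirect {A : Type*} [AddCommGroup A] (S : LeftBrace A) (q : ℕ) (χ : A → (ZMod q)ˣ)
    (hχ : ∀ a b, χ (S.mul a b + a + b) = χ a * χ b) : LeftBrace (A × ZMod q) where
  mul u v := (S.mul u.1 v.1, ((χ u.1 : ZMod q) - 1) * v.2)
  mul_add a b c := by
    ext
    · simp [S.mul_add]
    · simp [_root_.mul_add]
  circ_mul a b c := by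
    ext
    · simp [S.circ_mul]
    · simp only [Prod.fst_add, Prod.snd_add, hχ, Units.val_mul]
      ring
  bijective a := by
    have key : (fun x : A × ZMod q => (S.mul a.1 x.1, ((χ a.1 : ZMod q) - 1) * x.2) + x) =
        Prod.map (fun x => S.mul a.1 x + x) (fun c => (χ a.1 : ZMod q) * c) := by
      funext x
      ext
      · simp
      · simp only [Prod.snd_add, Prod.map_snd]
        ring
    rw [key]
    exact (S.bijective a.1).prodMap (Units.mulLeft_bijective (χ a.1))

/-- Powers of an `n`-th root of unity depend only on the exponent modulo `n`. -/
theorem zpow_congr {n q : ℕ} (ω : rootsOfUnity n (ZMod q)) {a b : ℤ}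
    (h : (a : ZMod n) = b) : (ω : (ZMod q)ˣ) ^ a = (ω : (ZMod q)ˣ) ^ b := by
  have h1 : (ω : (ZMod q)ˣ) ^ n = 1 := (mem_rootsOfUnity n _).1 ω.2
  obtain ⟨k, hk⟩ := (ZMod.intCast_eq_intCast_iff_dvd_sub a b n).1 h
  have hb : b = a + n * k := by omega
  rw [hb, zpow_add, zpow_mul, zpow_natCast, h1, one_zpow, mul_one]

theorem two_mul_choose {R : Type*} [CommRing R] (n : ℕ) :
    (2 : R) * (n.choose 2 : R) = n * n - n := by
  induction n with
  | zero => simp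
  | succ k ih =>
    rw [Nat.choose_succ_succ' k 1]
    push_cast [Nat.choose_one_right]
    linear_combination ih

theorem isUnit_two {p m : ℕ} [Fact p.Prime] (hp : 2 < p) (n : ℕ) (hm : m = p ^ n) :
    IsUnit (2 : ZMod m) := by
  have h : Nat.Coprime 2 m :=
    hm ▸ Nat.Coprime.pow_right _ ((Nat.coprime_primes Nat.prime_two Fact.out).2 hp.ne)
  simpa using (ZMod.isUnit_iff_coprime 2 m).2 h

/-- `T^{p,p,q}_{ω,μ}` on `ℤ_p² ⊕ ℤ_q`:
`((x₁, y₁), a₁) ⬝ ((x₂, y₂), a₂) = ((0, 0), (ω ^ x₁ μ ^ y₁ - 1) a₂)`. -/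
def Tppq (p q : ℕ) [Fact p.Prime] (ω μ : rootsOfUnity p (ZMod q)) :
    LeftBrace ((ZMod p × ZMod p) × ZMod q) :=
  semidirect (trivial (ZMod p × ZMod p)) q
    (fun v => (ω : (ZMod q)ˣ) ^ (v.1.val : ℤ) * (μ : (ZMod q)ˣ) ^ (v.2.val : ℤ)) (by
      intro a b
      rw [mul_mul_mul_comm, ← zpow_add, ← zpow_add]
      congr 1 <;> exact zpow_congr _ (by simp [trivial]))

/-- `T^{p²,q}_ω` on `ℤ_{p²} ⊕ ℤ_q`: `(x₁, a₁) ⬝ (x₂, a₂) = (0, (ω ^ x₁ - 1) a₂)`. -/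
def Tp2q (p q : ℕ) [Fact p.Prime] (ω : rootsOfUnity (p ^ 2) (ZMod q)) :
    LeftBrace (ZMod (p ^ 2) × ZMod q) :=
  semidirect (trivial (ZMod (p ^ 2))) q
    (fun x => (ω : (ZMod q)ˣ) ^ (x.val : ℤ)) (by
      intro a b
      rw [← zpow_add]
      exact zpow_congr _ (by simp [trivial]))

/-- `B^{p,p,q}_{ω,μ}` on `ℤ_p² ⊕ ℤ_q`: `((x₁, y₁), a₁) ⬝ ((x₂, y₂), a₂) =
((y₁ y₂, 0), (ω ^ (x₁ - C(y₁, 2)) μ ^ y₁ - 1) a₂)`. -/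
def Bppq (p q : ℕ) [Fact p.Prime] (hp : 2 < p) (ω μ : rootsOfUnity p (ZMod q)) :
    LeftBrace ((ZMod p × ZMod p) × ZMod q) :=
  semidirect (Bpp p) q
    (fun v => (ω : (ZMod q)ˣ) ^ ((v.1.val : ℤ) - (v.2.val.choose 2 : ℤ)) *
      (μ : (ZMod q)ˣ) ^ (v.2.val : ℤ)) (by
      intro a b
      rw [mul_mul_mul_comm, ← zpow_add, ← zpow_add]
      congr 1
      · refine zpow_congr _ ?_
        have h2 : IsUnit (2 : ZMod p) := isUnit_two hp 1 (pow_one p).symm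
        apply h2.mul_left_cancel
        have ha := two_mul_choose (R := ZMod p) a.2.val
        have hb := two_mul_choose (R := ZMod p) b.2.val
        have hab := two_mul_choose (R := ZMod p) (a.2 + b.2).val
        simp only [ZMod.natCast_zmod_val] at ha hb hab
        simp only [Bpp, Prod.fst_add, Prod.snd_add, zero_add, Int.cast_sub, Int.cast_add,
          Int.cast_natCast, ZMod.natCast_zmod_val]
        linear_combination ha + hb - hab
      · exact zpow_congr _ (by simp [Bpp]))

/-- `B^{p²,q}_ω` on `ℤ_{p²} ⊕ ℤ_q`:
`(x₁, a₁) ⬝ (x₂, a₂) = (p x₁ x₂, (ω ^ (x₁ - p C(x₁, 2)) - 1) a₂)`. -/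
def Bp2q (p q : ℕ) [Fact p.Prime] (hp : 2 < p) (ω : rootsOfUnity (p ^ 2) (ZMod q)) :
    LeftBrace (ZMod (p ^ 2) × ZMod q) :=
  semidirect (Bp2 p) q
    (fun x => (ω : (ZMod q)ˣ) ^ ((x.val : ℤ) - p * (x.val.choose 2 : ℤ))) (by
      intro a b
      rw [← zpow_add]
      refine zpow_congr _ ?_
      apply (isUnit_two hp 2 rfl).mul_left_cancel
      have hpp := p_mul_p p
      have ha := two_mul_choose (R := ZMod (p ^ 2)) a.val
      have hb := two_mul_choose (R := ZMod (p ^ 2)) b.val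
      have hab := two_mul_choose (R := ZMod (p ^ 2)) (p * a * b + a + b : ZMod (p ^ 2)).val
      simp only [ZMod.natCast_zmod_val] at ha hb hab
      simp only [Bp2, Int.cast_sub, Int.cast_add, Int.cast_mul,
        Int.cast_natCast, ZMod.natCast_zmod_val]
      linear_combination p * ha + p * hb - p * hab +
        (a * b - p * a ^ 2 * b ^ 2 - 2 * a * b * (a + b)) * hpp)

end LeftBrace

/-- A brace bundled with its underlying abelian group. -/
structure BundledBrace where
  carrier : Type
  [grp : AddCommGroup carrier]
  brace : LeftBrace carrier

attribute [instance] BundledBrace.grp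

/-- The positions in the list of braces of order `p² q`. -/
inductive FineIndex (p q : ℕ) : Type
  /-- four positions that are always present -/
  | Tpp_one
  | Tp2_one
  | Bpp_one
  | Bp2_one
  /-- positions that are present if `p ∣ q - 1` -/
  | Tpp_root (h : p ∣ q - 1)
  | Tp2_root (h : p ∣ q - 1)
  | Bpp_one_root (h : p ∣ q - 1)
  | Bpp_root_one (h : p ∣ q - 1)
  | Bpp_nonresidue (h : p ∣ q - 1)
  | Bp2_root (h : p ∣ q - 1) (i : Finset.Icc 1 (p - 1))
  /-- positions that are present if `p² ∣ q - 1` -/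
  | Tp2_root2 (h : p ^ 2 ∣ q - 1)
  | Bp2_root2 (h : p ^ 2 ∣ q - 1) (i : Finset.Icc 1 (p - 1))

/-- A `p`-th root of unity, regarded as a `p²`-th root of unity. -/
def rootIncl (p q : ℕ) : rootsOfUnity p (ZMod q) →* rootsOfUnity (p ^ 2) (ZMod q) :=
  Subgroup.inclusion (rootsOfUnity_le_of_dvd (dvd_pow_self p two_ne_zero))

/-- The list of braces of order `p² q`, built from a `p`-th root of unity `ω`, a `p²`-th root of
unity `ω'` and a residue class `η` modulo `p`. -/
def fineList (p q : ℕ) [Fact p.Prime] (hp : 2 < p) (ω : rootsOfUnity p (ZMod q))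
    (ω' : rootsOfUnity (p ^ 2) (ZMod q)) (η : ZMod p) : FineIndex p q → BundledBrace
  | .Tpp_one => ⟨_, LeftBrace.Tppq p q 1 1⟩
  | .Tp2_one => ⟨_, LeftBrace.Tp2q p q 1⟩
  | .Bpp_one => ⟨_, LeftBrace.Bppq p q hp 1 1⟩
  | .Bp2_one => ⟨_, LeftBrace.Bp2q p q hp 1⟩
  | .Tpp_root _ => ⟨_, LeftBrace.Tppq p q ω 1⟩
  | .Tp2_root _ => ⟨_, LeftBrace.Tp2q p q (rootIncl p q ω)⟩
  | .Bpp_one_root _ => ⟨_, LeftBrace.Bppq p q hp 1 ω⟩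
  | .Bpp_root_one _ => ⟨_, LeftBrace.Bppq p q hp ω 1⟩
  | .Bpp_nonresidue _ => ⟨_, LeftBrace.Bppq p q hp (ω ^ η.val) 1⟩
  | .Bp2_root _ i => ⟨_, LeftBrace.Bp2q p q hp (rootIncl p q (ω ^ (i : ℕ)))⟩
  | .Tp2_root2 _ => ⟨_, LeftBrace.Tp2q p q ω'⟩
  | .Bp2_root2 _ i => ⟨_, LeftBrace.Bp2q p q hp (ω' ^ (i : ℕ))⟩

/-! The adjoint group of a brace, with operation a∘b = a·b + a + b, acts on the additive group by
λ_a(b) = a·b + b. In order p²q the additive group is H ⊕ ℤ_q with |H| = p², and additivity makes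
every λ_a respect these coprime summands. The summand ℤ_q is then a brace with adjoint group of
order q, and counting fixed points shows that this group acts trivially on both summands; the
critical case q = p + 1 is excluded by parity. So a product depends only on the H-component of its
left factor, and λ acts on ℤ_q by scalars: the brace is the semidirect product given by a brace on H
and a character χ of its adjoint group (`exists_iso_semidirect`).

Groups of order p² are abelian, so the multiplication on H is commutative, hence biadditive, and
only four braces on H remain (`classify_card_sq`). A recursion along the adjoint product with a
generator determines their characters; the binomial coefficients measure how ∘ deviates from
addition (`exists_iso_family`).

Conversely, an isomorphism of two semidirect products restricts to an isomorphism of the braces of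
order p² that matches the characters (`exists_iso_of_semidirect_iso`). What remains is to find the
orbits of brace automorphisms on characters. For trivial braces only the order of χ survives.
Automorphisms of `Bpp p` have the form (x, y) ↦ (t²x + cy, ty), so the exponent of ω counts modulo
squares, whence the non-residue η. Automorphisms of `Bp2 p` are multiplications by units u ≡ 1 mod
p, so exponents count modulo p, whence the p - 1 braces. The four families themselves are told apart
by which integers kill the additive group and the products (`family_eq_iff`). -/

namespace LeftBrace

/-! ### Isomorphisms, transport of structure, and the adjoint group -/

variable {A B C : Type*} [AddCommGroup A] [AddCommGroup B] [AddCommGroup C]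

/-- The inverse of an isomorphism of braces. -/
def Iso.symm {S : LeftBrace A} {T : LeftBrace B} (e : S.Iso T) : T.Iso S where
  toAddEquiv := e.toAddEquiv.symm
  map_mul a b := by
    have h := e.map_mul (e.toAddEquiv.symm a) (e.toAddEquiv.symm b)
    apply e.toAddEquiv.injective
    simpa using h.symm

/-- The composite of isomorphisms of braces. -/
def Iso.trans {S : LeftBrace A} {T : LeftBrace B} {U : LeftBrace C} (e : S.Iso T) (f : T.Iso U) :
    S.Iso U where
  toAddEquiv := e.toAddEquiv.trans f.toAddEquiv
  map_mul a b := by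
    have h := e.map_mul a b
    have h' := f.map_mul (e.toAddEquiv a) (e.toAddEquiv b)
    simpa using (congrArg f.toAddEquiv h).trans h'

/-- Build an isomorphism of braces from an additive equivalence. -/
def Iso.ofAddEquiv {S : LeftBrace A} {T : LeftBrace B} (e : A ≃+ B)
    (h : ∀ a b, e (S.mul a b) = T.mul (e a) (e b)) : S.Iso T := ⟨e, h⟩

theorem Iso.apply_mul {S : LeftBrace A} {T : LeftBrace B} (e : S.Iso T) (a b : A) :
    e.toAddEquiv (S.mul a b) = T.mul (e.toAddEquiv a) (e.toAddEquiv b) := e.map_mul a b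

variable (S : LeftBrace A)

@[simp]
theorem mul_zero_eq (a : A) : S.mul a 0 = 0 := by
  simpa using S.mul_add a 0 0

-- Axiom (B2) at a = b = 0 says that 0·c lies in the kernel of x ↦ 0·x + x, which is injective by
-- (B3).
@[simp]
theorem zero_mul_eq (c : A) : S.mul 0 c = 0 := by
  have h := S.circ_mul 0 0 c
  apply (S.bijective 0).1
  simp only [mul_zero_eq, add_zero] at h ⊢
  exact add_eq_right.1 h.symm

/-- Left multiplication as an additive map. -/
def mulLeft (a : A) : A →+ A where
  toFun := S.mul a
  map_zero' := S.mul_zero_eq a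
  map_add' := S.mul_add a

@[simp]
theorem mulLeft_apply (a b : A) : S.mulLeft a b = S.mul a b := rfl

/-- A brace structure transported along an additive equivalence. -/
def transport (e : A ≃+ B) : LeftBrace B where
  mul a b := e (S.mul (e.symm a) (e.symm b))
  mul_add a b c := by simp [S.mul_add]
  circ_mul a b c := by simp [S.circ_mul]
  bijective a := by
    have : (fun x => e (S.mul (e.symm a) (e.symm x)) + x) =
        e ∘ (fun x => S.mul (e.symm a) x + x) ∘ e.symm := by
      funext x
      simp
    rw [this]
    exact e.bijective.comp ((S.bijective _).comp e.symm.bijective)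

/-- The transported brace is isomorphic to the original one. -/
def transportIso (e : A ≃+ B) : S.Iso (S.transport e) :=
  Iso.ofAddEquiv e fun a b => by simp [transport]

/-- The elements of the adjoint group of a brace. -/
@[ext]
structure Adj (S : LeftBrace A) where
  /-- the underlying element of the brace -/
  val : A

variable {S}

/-- Associativity is (B2) combined with left distributivity. By (B3) there is x with a·x + x = -a,
and this x is the inverse of a. -/
noncomputable instance : Group S.Adj :=
  letI : Mul S.Adj := ⟨fun a b => ⟨S.mul a.val b.val + a.val + b.val⟩⟩
  letI : One S.Adj := ⟨⟨0⟩⟩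
  letI : Inv S.Adj := ⟨fun a => ⟨((S.bijective a.val).2 (-a.val)).choose⟩⟩
  Group.ofRightAxioms
    (fun a b c => by
      ext
      change S.mul (S.mul a.val b.val + a.val + b.val) c.val + (S.mul a.val b.val + a.val + b.val) +
        c.val = S.mul a.val (S.mul b.val c.val + b.val + c.val) + a.val +
          (S.mul b.val c.val + b.val + c.val)
      rw [S.circ_mul, S.mul_add, S.mul_add]
      abel)
    (fun a => by
      ext
      change S.mul a.val 0 + a.val + 0 = a.val
      simp)
    (fun a => by
      have h := ((S.bijective a.val).2 (-a.val)).choose_spec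
      ext
      change S.mul a.val (((S.bijective a.val).2 (-a.val)).choose) + a.val + _ = 0
      exact (add_right_comm _ _ _).trans ((congrArg (· + a.val) h).trans (neg_add_cancel _)))

theorem Adj.val_mul (a b : S.Adj) : (a * b).val = S.mul a.val b.val + a.val + b.val := rfl

theorem Adj.natCard : Nat.card S.Adj = Nat.card A :=
  Nat.card_congr ⟨Adj.val, Adj.mk, fun _ => rfl, fun _ => rfl⟩

/-- This is the action λ_a(b) = a·b + b; its compatibility with the adjoint product is a restatement
of (B2). -/
instance : DistribMulAction S.Adj A where
  smul a b := S.mul a.val b + b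
  one_smul b := by
    change S.mul 0 b + b = b
    simp
  mul_smul a b c := by
    change S.mul (S.mul a.val b.val + a.val + b.val) c + c =
      S.mul a.val (S.mul b.val c + c) + (S.mul b.val c + c)
    rw [S.circ_mul, S.mul_add]
    abel
  smul_zero a := by
    change S.mul a.val 0 + 0 = 0
    simp
  smul_add a b c := by
    change S.mul a.val (b + c) + (b + c) = S.mul a.val b + b + (S.mul a.val c + c)
    rw [S.mul_add]
    abel

end LeftBrace

/-! ### Fixed points of prime-power order groups acting on abelian groups -/

theorem card_fixedPoints_modEq {r n : ℕ} [Fact r.Prime] {G X : Type*} [Group G] [AddCommGroup X]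
    [DistribMulAction G X] [Finite X] (hG : Nat.card G = r ^ n) :
    Nat.card X ≡ Nat.card (FixedPoints.addSubgroup G X) [MOD r] :=
  (IsPGroup.of_card hG).card_modEq_card_fixedPoints X

theorem fixedPoints_ne_bot {r n : ℕ} [Fact r.Prime] {G X : Type*} [Group G] [AddCommGroup X]
    [DistribMulAction G X] [Finite X] (hG : Nat.card G = r ^ n) (hX : r ∣ Nat.card X) :
    FixedPoints.addSubgroup G X ≠ ⊥ := by
  intro h
  have := card_fixedPoints_modEq (X := X) hG
  rw [h, AddSubgroup.card_bot] at this
  have h1 := (this.dvd_iff dvd_rfl).1 hX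
  exact (Fact.out : r.Prime).one_lt.ne' (Nat.dvd_one.1 h1)

/-- A group of prime order `r` acts trivially on a group of order `r`. -/
theorem smul_eq_self_of_card_eq {r : ℕ} [Fact r.Prime] {G X : Type*} [Group G] [AddCommGroup X]
    [DistribMulAction G X] (hG : Nat.card G = r) (hX : Nat.card X = r) (g : G) (x : X) :
    g • x = x := by
  have : Finite X := Nat.finite_of_card_ne_zero (hX ▸ (Fact.out : r.Prime).ne_zero)
  have h := fixedPoints_ne_bot (X := X) (n := 1) (hG.trans (pow_one r).symm) hX.symm.dvd
  have h2 := (FixedPoints.addSubgroup G X).card_addSubgroup_dvd_card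
  rw [hX, Nat.dvd_prime Fact.out] at h2
  have h3 : FixedPoints.addSubgroup G X = ⊤ := by
    rcases h2 with h2 | h2
    · exact absurd (AddSubgroup.card_eq_one.1 h2) h
    · exact AddSubgroup.eq_top_of_card_eq _ (h2.trans hX.symm)
  have : x ∈ FixedPoints.addSubgroup G X := h3 ▸ AddSubgroup.mem_top x
  exact this g

/-- A group of prime order `q` acts trivially on a group of order `p²`, if `2 < p < q`. -/
theorem smul_eq_self_of_card_sq {p q : ℕ} [Fact p.Prime] [Fact q.Prime] (hp : 2 < p) (hpq : p < q)
    {G X : Type*} [Group G] [AddCommGroup X]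
    [DistribMulAction G X] (hG : Nat.card G = q) (hX : Nat.card X = p ^ 2) (g : G) (x : X) :
    g • x = x := by
  have hpp : p.Prime := Fact.out
  have hqq : q.Prime := Fact.out
  have : Finite X := Nat.finite_of_card_ne_zero (hX ▸ pow_ne_zero 2 hpp.ne_zero)
  have h := card_fixedPoints_modEq (X := X) (n := 1) (hG.trans (pow_one q).symm)
  have h2 := (FixedPoints.addSubgroup G X).card_addSubgroup_dvd_card
  rw [hX] at h h2
  have hq1 : ¬ q ∣ p - 1 := fun hd => by
    have := Nat.le_of_dvd (by omega) hd
    omega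
  have h3 : FixedPoints.addSubgroup G X = ⊤ := by
    apply AddSubgroup.eq_top_of_card_eq
    rw [hX]
    obtain ⟨k, hk, hkc⟩ := (Nat.dvd_prime_pow hpp).1 h2
    rw [hkc] at h ⊢
    -- The fixed points form a subgroup of order p^k with q ∣ p² - p^k. For k = 0 this forces q = p
    -- + 1 or q ∣ p - 1, for k = 1 it forces q ∣ p or q ∣ p - 1; all are impossible for odd p < q.
    have h4 := (Nat.modEq_iff_dvd' (Nat.pow_le_pow_right hpp.pos hk)).1 h.symm
    interval_cases k
    · have h5 : p ^ 2 - p ^ 0 = (p + 1) * (p - 1) := by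
        rw [← Nat.sq_sub_sq]; simp
      rw [h5] at h4
      rcases hqq.dvd_mul.1 h4 with h6 | h6
      · have h7 : q = p + 1 := le_antisymm (Nat.le_of_dvd (by omega) h6) hpq
        rcases hpp.eq_two_or_odd' with h8 | h8
        · omega
        · rcases hqq.eq_two_or_odd' with h9 | h9
          · omega
          · rw [h7] at h9
            exact absurd h8.add_one (Nat.not_even_iff_odd.2 h9)
      · exact absurd h6 hq1
    · have h5 : p ^ 2 - p ^ 1 = p * (p - 1) := by
        rw [Nat.mul_sub, pow_two, pow_one, mul_one]
      rw [h5] at h4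
      rcases hqq.dvd_mul.1 h4 with h6 | h6
      · exact absurd (Nat.le_of_dvd hpp.pos h6) (by omega)
      · exact absurd h6 hq1
    · rfl
  have : x ∈ FixedPoints.addSubgroup G X := h3 ▸ AddSubgroup.mem_top x
  exact this g

/-! ### Coprime splitting of the additive group -/

theorem exists_addEquiv_prod_zmod {p q : ℕ} [Fact p.Prime] [Fact q.Prime] (hpq : p ≠ q)
    {A : Type*} [AddCommGroup A] (hA : Nat.card A = p ^ 2 * q) :
    ∃ H : AddSubgroup A, Nat.card H = p ^ 2 ∧ Nonempty (A ≃+ H × ZMod q) := by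
  have hpp : p.Prime := Fact.out
  have hqq : q.Prime := Fact.out
  have : Finite A := Nat.finite_of_card_ne_zero
    (hA ▸ Nat.mul_ne_zero (pow_ne_zero 2 hpp.ne_zero) hqq.ne_zero)
  have hM : Nat.card (Multiplicative A) = p ^ 2 * q := hA
  obtain ⟨H', hH'⟩ := Sylow.exists_subgroup_card_pow_prime (G := Multiplicative A) p
    (n := 2) (hM ▸ dvd_mul_right _ _)
  obtain ⟨K', hK'⟩ := Sylow.exists_subgroup_card_pow_prime (G := Multiplicative A) q
    (n := 1) (by rw [hM, pow_one]; exact dvd_mul_left _ _)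
  rw [pow_one] at hK'
  have hcop : (Nat.card H').Coprime (Nat.card K') := by
    rw [hH', hK']
    exact Nat.Coprime.pow_left 2 ((Nat.coprime_primes hpp hqq).2 hpq)
  have hc : Subgroup.IsComplement' H' K' :=
    Subgroup.isComplement'_of_coprime (by rw [hH', hK', hM]) hcop
  let H := Subgroup.toAddSubgroup' H'
  let K := Subgroup.toAddSubgroup' K'
  have hK : Nat.card K = q := hK'
  have : IsAddCyclic K := isAddCyclic_of_prime_card hK
  have e : ZMod q ≃+ K := (ZMod.ringEquivCongr hK.symm).toAddEquiv.trans
    (zmodAddCyclicAddEquiv this)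
  -- Being complements means by definition that the product map is bijective, and this unfolds to
  -- the additive coproduct.
  have hb : Function.Bijective (H.subtype.coprod K.subtype) := hc
  exact ⟨H, hH', ⟨((AddEquiv.ofBijective _ hb).symm).trans
    ((AddEquiv.refl H).prodCongr e.symm)⟩⟩

/-- The integer p² kills the source, but it is invertible in ℤ_q. -/
theorem map_inl_snd {p q : ℕ} [Fact p.Prime] [Fact q.Prime] (hpq : p ≠ q) {A B : Type*}
    [AddCommGroup A] [AddCommGroup B] (hA : Nat.card A = p ^ 2)
    (f : A × ZMod q →+ B × ZMod q) (a : A) : (f (a, 0)).2 = 0 := by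
  have h1 : p ^ 2 • f (a, 0) = 0 := by
    rw [← map_nsmul, Prod.smul_mk, ← hA, card_nsmul_eq_zero']
    simp [Prod.mk_zero_zero]
  have h2 := congrArg Prod.snd h1
  rw [Prod.smul_snd, Prod.snd_zero, nsmul_eq_mul] at h2
  refine (mul_eq_zero.1 h2).resolve_left fun h3 => ?_
  rw [Nat.cast_pow] at h3
  have h4 := (ZMod.natCast_eq_zero_iff _ _).1 (eq_zero_of_pow_eq_zero h3)
  exact hpq ((Nat.prime_dvd_prime_iff_eq Fact.out Fact.out).1 h4).symm

/-- The additive order of the component divides both q and p². -/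
theorem map_inr_fst {p q : ℕ} [Fact p.Prime] [Fact q.Prime] (hpq : p ≠ q) {A B : Type*}
    [AddCommGroup A] [AddCommGroup B] (hB : Nat.card B = p ^ 2)
    (f : A × ZMod q →+ B × ZMod q) (c : ZMod q) : (f (0, c)).1 = 0 := by
  have h1 : q • f (0, c) = 0 := by
    rw [← map_nsmul, Prod.smul_mk]
    simp [Prod.mk_zero_zero]
  have h2 := congrArg Prod.fst h1
  rw [Prod.smul_fst, Prod.fst_zero] at h2
  have h3 : p ^ 2 • (f (0, c)).1 = 0 := by rw [← hB, card_nsmul_eq_zero']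
  have h4 := Nat.dvd_gcd (addOrderOf_dvd_of_nsmul_eq_zero h2) (addOrderOf_dvd_of_nsmul_eq_zero h3)
  have hcop : q.gcd (p ^ 2) = 1 :=
    Nat.Coprime.pow_right 2 ((Nat.coprime_primes Fact.out Fact.out).2 hpq.symm)
  rw [hcop, Nat.dvd_one] at h4
  exact AddMonoid.addOrderOf_eq_one_iff.1 h4

/-! ### Reduction to semidirect products -/

namespace LeftBrace

variable {H : Type*} [AddCommGroup H] {p q : ℕ}

section Split

variable (T : LeftBrace (H × ZMod q))

theorem mul_eq_of_split (hl : ∀ a h, (T.mul a (h, 0)).2 = 0) (hr : ∀ a c, (T.mul a (0, c)).1 = 0)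
    (a b : H × ZMod q) : T.mul a b = ((T.mul a (b.1, 0)).1, (T.mul a (0, b.2)).2) := by
  have h : T.mul a b = T.mul a (b.1, 0) + T.mul a (0, b.2) := by
    rw [← T.mul_add]
    simp
  rw [h]
  ext <;> simp [hl, hr]

/-- The induced brace on the first factor of a product on which all left multiplications act
componentwise. -/
def inlPart (hl : ∀ a h, (T.mul a (h, 0)).2 = 0) (hr : ∀ a c, (T.mul a (0, c)).1 = 0) :
    LeftBrace H where
  mul a b := (T.mul (a, 0) (b, 0)).1
  mul_add a b c := by
    rw [← Prod.fst_add, ← T.mul_add]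
    simp
  circ_mul a b c := by
    have h := T.circ_mul (a, 0) (b, 0) (c, 0)
    have h1 : ∀ x y : H, T.mul (x, 0) (y, 0) = ((T.mul (x, 0) (y, 0)).1, 0) :=
      fun x y => Prod.ext rfl (hl _ _)
    rw [h1 a b, h1 b c] at h
    simpa using congrArg Prod.fst h
  bijective a := by
    constructor
    · intro x y hxy
      have : (x, (0 : ZMod q)) = (y, 0) := (T.bijective (a, 0)).1 (by
        ext
        · simpa using hxy
        · simp [hl])
      exact congrArg Prod.fst this
    · intro y
      obtain ⟨x, hx⟩ := (T.bijective (a, 0)).2 (y, 0)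
      simp only at hx
      rw [T.mul_eq_of_split hl hr] at hx
      exact ⟨x.1, congrArg Prod.fst hx⟩

/-- The induced brace on the second factor of a product on which all left multiplications act
componentwise. -/
def inrPart (hl : ∀ a h, (T.mul a (h, 0)).2 = 0) (hr : ∀ a c, (T.mul a (0, c)).1 = 0) :
    LeftBrace (ZMod q) where
  mul a b := (T.mul (0, a) (0, b)).2
  mul_add a b c := by
    rw [← Prod.snd_add, ← T.mul_add]
    simp
  circ_mul a b c := by
    have h := T.circ_mul (0, a) (0, b) (0, c)
    have h1 : ∀ x y : ZMod q, T.mul (0, x) (0, y) = (0, (T.mul (0, x) (0, y)).2) :=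
      fun x y => Prod.ext (hr _ _) rfl
    rw [h1 a b, h1 b c] at h
    simpa using congrArg Prod.snd h
  bijective a := by
    constructor
    · intro x y hxy
      have : ((0 : H), x) = (0, y) := (T.bijective (0, a)).1 (by
        ext
        · simp [hr]
        · simpa using hxy)
      exact congrArg Prod.snd this
    · intro y
      obtain ⟨x, hx⟩ := (T.bijective (0, a)).2 (0, y)
      simp only at hx
      rw [T.mul_eq_of_split hl hr] at hx
      exact ⟨x.2, congrArg Prod.snd hx⟩

/-- The adjoint group of the brace induced on the second factor acts on the first factor. -/
@[reducible]
def inrPartAction (hl : ∀ a h, (T.mul a (h, 0)).2 = 0) (hr : ∀ a c, (T.mul a (0, c)).1 = 0) :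
    DistribMulAction (T.inrPart hl hr).Adj H where
  smul a h := (T.mul (0, a.val) (h, 0)).1 + h
  one_smul h := by
    change (T.mul (0, 0) (h, 0)).1 + h = h
    simp [Prod.mk_zero_zero]
  mul_smul a b h := by
    change (T.mul (0, (T.mul (0, a.val) (0, b.val)).2 + a.val + b.val) (h, 0)).1 + h =
      (T.mul (0, a.val) ((T.mul (0, b.val) (h, 0)).1 + h, 0)).1 + ((T.mul (0, b.val) (h, 0)).1 + h)
    have h1 := T.circ_mul (0, a.val) (0, b.val) (h, 0)
    have h2 : T.mul (0, a.val) (0, b.val) = (0, (T.mul (0, a.val) (0, b.val)).2) :=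
      Prod.ext (hr _ _) rfl
    have h3 : T.mul (0, b.val) (h, 0) = ((T.mul (0, b.val) (h, 0)).1, 0) :=
      Prod.ext rfl (hl _ _)
    have h4 : ((T.mul (0, b.val) (h, 0)).1 + h, (0 : ZMod q)) =
        T.mul (0, b.val) (h, 0) + (h, 0) := by
      rw [h3]
      simp
    have h5 : ((0 : H), (T.mul (0, a.val) (0, b.val)).2 + a.val + b.val) =
        T.mul (0, a.val) (0, b.val) + (0, a.val) + (0, b.val) := by
      rw [h2]
      simp
    rw [h4, T.mul_add, h5, h1]
    simp only [Prod.fst_add]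
    abel
  smul_zero a := by
    change (T.mul (0, a.val) (0, 0)).1 + 0 = 0
    simp [Prod.mk_zero_zero]
  smul_add a b c := by
    change (T.mul (0, a.val) (b + c, 0)).1 + (b + c) =
      (T.mul (0, a.val) (b, 0)).1 + b + ((T.mul (0, a.val) (c, 0)).1 + c)
    have h : ((b + c, 0) : H × ZMod q) = (b, 0) + (c, 0) := by simp
    rw [h, T.mul_add, Prod.fst_add]
    abel

/-- The elements (0, c) form a group of order q under the adjoint operation. It acts trivially on
ℤ_q, as any group of order q does, and on H by the fixed point count. -/
theorem inr_mul [Fact p.Prime] [Fact q.Prime] (hp : 2 < p) (hpq : p < q)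
    (hl : ∀ a h, (T.mul a (h, 0)).2 = 0) (hr : ∀ a c, (T.mul a (0, c)).1 = 0)
    (hH : Nat.card H = p ^ 2) (c : ZMod q) (b : H × ZMod q) : T.mul (0, c) b = 0 := by
  let := T.inrPartAction hl hr
  have hG : Nat.card (T.inrPart hl hr).Adj = q := Adj.natCard.trans (Nat.card_zmod q)
  have h1 := smul_eq_self_of_card_eq hG (Nat.card_zmod q) ⟨c⟩ b.2
  have h2 := smul_eq_self_of_card_sq hp hpq hG hH ⟨c⟩ b.1
  rw [T.mul_eq_of_split hl hr]
  exact Prod.ext (add_eq_right.1 h2) (add_eq_right.1 h1)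

/-- Because (0, c) acts trivially, (0, c)∘(h, 0) = (h, c), and (h, c) acts as (h, 0) does. -/
theorem mul_eq_inl_mul [Fact p.Prime] [Fact q.Prime] (hp : 2 < p) (hpq : p < q)
    (hl : ∀ a h, (T.mul a (h, 0)).2 = 0) (hr : ∀ a c, (T.mul a (0, c)).1 = 0)
    (hH : Nat.card H = p ^ 2) (a b : H × ZMod q) : T.mul a b = T.mul (a.1, 0) b := by
  have h0 := T.inr_mul hp hpq hl hr hH a.2
  have h := T.circ_mul (0, a.2) (a.1, 0) b
  simpa [h0] using h

end Split

theorem exists_iso_semidirect [Fact p.Prime] [Fact q.Prime] (hp : 2 < p) (hpq : p < q)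
    {A : Type*} [AddCommGroup A] (S : LeftBrace A) (hA : Nat.card A = p ^ 2 * q) :
    ∃ (H : AddSubgroup A) (T : LeftBrace H) (χ : H → (ZMod q)ˣ)
      (hχ : ∀ a b, χ (T.mul a b + a + b) = χ a * χ b),
      Nat.card H = p ^ 2 ∧ Nonempty (S.Iso (T.semidirect q χ hχ)) := by
  obtain ⟨H, hH, ⟨e⟩⟩ := exists_addEquiv_prod_zmod hpq.ne hA
  obtain ⟨T, ⟨i⟩⟩ : ∃ T : LeftBrace (H × ZMod q), Nonempty (S.Iso T) := ⟨_, ⟨S.transportIso e⟩⟩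
  have hl := fun a => map_inl_snd hpq.ne hH (T.mulLeft a)
  have hr := fun a => map_inr_fst hpq.ne hH (T.mulLeft a)
  simp only [mulLeft_apply] at hl hr
  have hlin : ∀ (a : H) (c : ZMod q), (T.mul (a, 0) (0, c)).2 = (T.mul (a, 0) (0, 1)).2 * c := by
    intro a c
    let f : ZMod q →+ ZMod q :=
      ((AddMonoidHom.snd H (ZMod q)).comp (T.mulLeft (a, 0))).comp (AddMonoidHom.inr H (ZMod q))
    have h := ZMod.map_smul f c 1
    rw [smul_eq_mul, smul_eq_mul, mul_one, mul_comm] at h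
    exact h
  -- This is the scalar by which λ of (a, 0) acts on ℤ_q; it is nonzero because λ is injective.
  let g : H → ZMod q := fun a => (T.mul (a, 0) (0, 1)).2 + 1
  have hg : ∀ a, g a ≠ 0 := by
    intro a ha
    have : ((0 : H), (1 : ZMod q)) = (0, 0) := (T.bijective (a, 0)).1 (by
      simp only
      ext
      · simp [hr, Prod.mk_zero_zero]
      · simpa [Prod.mk_zero_zero] using ha)
    simp at this
  have hval : ∀ a b, T.mul a b = ((T.mul (a.1, 0) (b.1, 0)).1, (g a.1 - 1) * b.2) := by
    intro a b
    rw [T.mul_eq_inl_mul hp hpq hl hr hH, T.mul_eq_of_split hl hr, hlin]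
    simp [g]
  refine ⟨H, T.inlPart hl hr, fun a => Units.mk0 (g a) (hg a), fun a b => ?_, hH,
    ⟨i.trans (Iso.ofAddEquiv (AddEquiv.refl _) fun a b => hval a b)⟩⟩
  ext
  have h := congrArg Prod.snd (T.circ_mul (a, 0) (b, 0) (0, 1))
  have hsnd : ∀ a b, (T.mul a b).2 = (g a.1 - 1) * b.2 := fun a b => congrArg Prod.snd (hval a b)
  simp only [hsnd, Prod.snd_add, Prod.fst_add] at h
  change g ((T.mul (a, 0) (b, 0)).1 + a + b) = g a * g b
  linear_combination h

end LeftBrace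

/-! ### Braces of order p² -/

namespace LeftBrace

variable {p : ℕ} {B : Type*} [AddCommGroup B]

/-- Groups of order p² are abelian; cancelling a + b in a∘b = b∘a leaves the products. -/
theorem mul_comm_of_card_sq [Fact p.Prime] (T : LeftBrace B) (hB : Nat.card B = p ^ 2) (a b : B) :
    T.mul a b = T.mul b a := by
  have hG : Nat.card T.Adj = p ^ 2 := Adj.natCard.trans hB
  have h := congrArg Adj.val 
    ((IsPGroup.isMulCommutative_of_card_eq_prime_sq hG).is_comm.comm (⟨a⟩ : T.Adj) ⟨b⟩)
  rw [Adj.val_mul, Adj.val_mul, add_assoc, add_assoc, add_comm b a] at h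
  exact add_right_cancel h

/-- A brace of order `p²` whose additive group is cyclic. -/
theorem classify_zmod_sq [Fact p.Prime] (T : LeftBrace (ZMod (p ^ 2))) :
    Nonempty (T.Iso (trivial (ZMod (p ^ 2)))) ∨ Nonempty (T.Iso (Bp2 p)) := by
  have hcomm := T.mul_comm_of_card_sq (p := p) (Nat.card_zmod _)
  have hr : ∀ a b, T.mul a b = T.mul a 1 * b := by
    intro a b
    have h := ZMod.map_smul (T.mulLeft a) b 1
    rwa [smul_eq_mul, smul_eq_mul, mul_one, mul_comm] at h
  set s := T.mul 1 1 with hs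
  have hmul : ∀ a b, T.mul a b = s * a * b := by
    intro a b
    rw [hr, hcomm, hr]
  have hsu : ¬ IsUnit s := by
    rintro ⟨u, hu⟩
    -- If s were a unit, λ of -s⁻¹ would send 1 to -1 + 1 = 0.
    have h : (1 : ZMod (p ^ 2)) = 0 := (T.bijective (-(u⁻¹ : (ZMod (p ^ 2))ˣ))).1 (by
      simp [hmul, ← hu])
    have : Fact (1 < p ^ 2) := ⟨Nat.one_lt_pow two_ne_zero (Fact.out : p.Prime).one_lt⟩
    exact one_ne_zero h
  have hpd : p ∣ s.val := by
    by_contra hd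
    apply hsu
    rw [← ZMod.natCast_zmod_val s]
    exact (ZMod.isUnit_iff_coprime _ _).2 (Nat.Coprime.pow_right 2
      (((Fact.out : p.Prime).coprime_iff_not_dvd.2 hd).symm))
  obtain ⟨t, ht⟩ := hpd
  have hst : s = p * t := by rw [← ZMod.natCast_zmod_val s, ht, Nat.cast_mul]
  by_cases hpt : p ∣ t
  · left
    obtain ⟨t', rfl⟩ := hpt
    have h0 : s = 0 := by
      rw [hst]
      push_cast
      linear_combination (t' : ZMod (p ^ 2)) * p_mul_p p
    exact ⟨Iso.ofAddEquiv (AddEquiv.refl _) fun a b => by simp [hmul, h0, trivial]⟩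
  · right
    have hu : IsUnit (t : ZMod (p ^ 2)) := (ZMod.isUnit_iff_coprime _ _).2 (Nat.Coprime.pow_right 2
      (((Fact.out : p.Prime).coprime_iff_not_dvd.2 hpt).symm))
    obtain ⟨u, hu⟩ := hu
    -- Rescaling by the unit t turns the coefficient s = pt into p.
    refine ⟨Iso.ofAddEquiv (AddAut.mulLeft u) fun a b => ?_⟩
    simp only [AddAut.mulLeft_apply_apply, Units.smul_def, smul_eq_mul, hmul, hst, ← hu, Bp2]
    ring

/-- Two elements of a group of order `p²` that is killed by `p` form a basis if they are
independent. -/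
theorem exists_addEquiv_of_independent [Fact p.Prime] [Module (ZMod p) B]
    (hB : Nat.card B = p ^ 2) (z y : B)
    (h : ∀ u v : ZMod p, u • z + v • y = 0 → u = 0 ∧ v = 0) :
    ∃ e : (ZMod p × ZMod p) ≃+ B, ∀ u v, e (u, v) = u • z + v • y := by
  let f : ZMod p × ZMod p →+ B :=
    { toFun := fun w => w.1 • z + w.2 • y
      map_zero' := by simp
      map_add' := fun a b => by
        simp only [Prod.fst_add, Prod.snd_add, add_smul]
        abel }
  have hinj : Function.Injective f := by
    rw [injective_iff_map_eq_zero]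
    intro w hw
    exact Prod.ext (h _ _ hw).1 (h _ _ hw).2
  have : Finite B := Nat.finite_of_card_ne_zero
    (hB ▸ pow_ne_zero 2 (Fact.out : p.Prime).ne_zero)
  have hbij : Function.Bijective f := by
    refine (Nat.bijective_iff_injective_and_card f).2 ⟨hinj, ?_⟩
    rw [hB, Nat.card_prod, Nat.card_zmod, pow_two]
  exact ⟨AddEquiv.ofBijective f hbij, fun u v => rfl⟩

theorem exists_smul_of_mem_fixed [Fact p.Prime] [Module (ZMod p) B]
    {F : AddSubgroup B} {y f : B} (hy : y ∉ F) (hf : f ∈ F) (hf0 : f ≠ 0) (u v : ZMod p)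
    (h : u • f + v • y = 0) : u = 0 ∧ v = 0 := by
  have hF : ∀ (c : ZMod p) {x : B}, x ∈ F → c • x ∈ F := fun c x hx => by
    rw [← ZMod.natCast_zmod_val c, Nat.cast_smul_eq_nsmul]
    exact F.nsmul_mem hx _
  have hv : v = 0 := by
    by_contra hv
    apply hy
    have h1 : v • y ∈ F := by
      rw [eq_neg_of_add_eq_zero_right h]
      exact F.neg_mem (hF u hf)
    simpa [smul_smul, inv_mul_cancel₀ hv] using hF v⁻¹ h1
  subst hv
  simpa [hf0] using h

/-- The multiplication is a symmetric bilinear map, and the fixed points F of the adjoint group are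
its annihilator, which is nonzero. If F is not everything, any y outside F has y·y ∈ F nonzero, and
the basis (y·y, y) gives the standard form. -/
theorem classify_elementary [Fact p.Prime] [Module (ZMod p) B] (T : LeftBrace B)
    (hB : Nat.card B = p ^ 2) :
    Nonempty (T.Iso (trivial (ZMod p × ZMod p))) ∨ Nonempty (T.Iso (Bpp p)) := by
  have hpp : p.Prime := Fact.out
  have hcomm := T.mul_comm_of_card_sq hB
  have : Finite B := Nat.finite_of_card_ne_zero (hB ▸ pow_ne_zero 2 hpp.ne_zero)
  set F := FixedPoints.addSubgroup T.Adj B with hF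
  have hmem : ∀ f, f ∈ F ↔ ∀ a, T.mul a f = 0 := fun f =>
    ⟨fun h a => add_eq_right.1 (h ⟨a⟩), fun h a => add_eq_right.2 (h a.val)⟩
  have hbot : F ≠ ⊥ := fixedPoints_ne_bot (Adj.natCard.trans hB) (hB ▸ dvd_pow_self p two_ne_zero)
  obtain ⟨f, hf, hf0⟩ := F.bot_or_exists_ne_zero.resolve_left hbot
  by_cases htop : F = ⊤
  · left
    have hr : Module.finrank (ZMod p) B = 2 := by
      have h := Module.natCard_eq_pow_finrank (K := ZMod p) (V := B)
      rw [hB, Nat.card_zmod] at h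
      exact (Nat.pow_right_injective hpp.two_le h).symm
    have e : B ≃ₗ[ZMod p] (ZMod p × ZMod p) := LinearEquiv.ofFinrankEq _ _ (by rw [hr]; simp)
    refine ⟨Iso.ofAddEquiv e.toAddEquiv fun a b => ?_⟩
    have hb : b ∈ F := htop ▸ AddSubgroup.mem_top b
    rw [(hmem b).1 hb a, map_zero]
    rfl
  · right
    obtain ⟨y, hy⟩ : ∃ y, y ∉ F := by
      by_contra! h
      exact htop (F.eq_top_iff'.2 h)
    obtain ⟨e, he⟩ := exists_addEquiv_of_independent hB f y (exists_smul_of_mem_fixed hy hf hf0)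
    have hsm : ∀ a (c : ZMod p) b, T.mul a (c • b) = c • T.mul a b :=
      fun a c b => ZMod.map_smul (T.mulLeft a) c b
    obtain ⟨⟨β, α⟩, hαβ⟩ := e.surjective (T.mul y y)
    rw [he] at hαβ
    have hff := (hmem f).1 hf
    -- For α ≠ 0, the map λ of -α⁻¹y takes the same value -α⁻¹βf at y and at -α⁻¹βf; injectivity
    -- then puts y into F.
    have hα : α = 0 := by
      by_contra hα
      apply hy
      have h1 : y = -(α⁻¹ * β) • f := (T.bijective (-α⁻¹ • y)).1 (by
        simp only [hsm, hff, smul_zero, zero_add]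
        rw [hcomm, hsm, ← hαβ, smul_add, smul_smul, smul_smul]
        simp [inv_mul_cancel₀ hα])
      rw [h1, hmem]
      intro a
      rw [hsm, hff, smul_zero]
    subst hα
    rw [zero_smul, add_zero] at hαβ
    -- Otherwise y is annihilated by both basis vectors f and y.
    have hβ : β ≠ 0 := by
      rintro rfl
      apply hy
      rw [hmem]
      intro a
      obtain ⟨⟨u, v⟩, rfl⟩ := e.surjective a
      rw [hcomm, he, T.mul_add, hsm, hsm, hff, ← hαβ]
      simp
    have hz : β • f ∈ F := by
      rw [hmem]
      intro a
      rw [hsm, hff, smul_zero]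
    obtain ⟨e', he'⟩ := exists_addEquiv_of_independent hB (β • f) y
      (exists_smul_of_mem_fixed hy hz (smul_ne_zero hβ hf0))
    have hyc : ∀ c, T.mul (e' c) y = c.2 • β • f := by
      rintro ⟨u, v⟩
      rw [hcomm, he', T.mul_add, hsm, hsm, hsm, hff, ← hαβ]
      simp
    refine ⟨(Iso.ofAddEquiv e' fun a b => ?_ : (Bpp p).Iso T).symm⟩
    obtain ⟨u, v⟩ := b
    rw [he' u v, T.mul_add, hsm, hsm, hsm, hff, hyc]
    simp only [Bpp]
    rw [he']
    simp [smul_smul, mul_comm, mul_left_comm]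

/-- The braces of order `p²`. -/
theorem classify_card_sq [Fact p.Prime] (T : LeftBrace B) (hB : Nat.card B = p ^ 2) :
    Nonempty (T.Iso (trivial (ZMod p × ZMod p))) ∨ Nonempty (T.Iso (trivial (ZMod (p ^ 2)))) ∨
      Nonempty (T.Iso (Bpp p)) ∨ Nonempty (T.Iso (Bp2 p)) := by
  have hpp : p.Prime := Fact.out
  by_cases hc : IsAddCyclic B
  · have e : ZMod (p ^ 2) ≃+ B :=
      (ZMod.ringEquivCongr hB.symm).toAddEquiv.trans (zmodAddCyclicAddEquiv hc)
    have i := T.transportIso e.symm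
    rcases classify_zmod_sq (T.transport e.symm) with ⟨⟨j⟩⟩ | ⟨⟨j⟩⟩
    · exact Or.inr (Or.inl ⟨i.trans j⟩)
    · exact Or.inr (Or.inr (Or.inr ⟨i.trans j⟩))
  · have : Finite B := Nat.finite_of_card_ne_zero (hB ▸ pow_ne_zero 2 hpp.ne_zero)
    have hk : ∀ b : B, p • b = 0 := by
      intro b
      rw [← addOrderOf_dvd_iff_nsmul_eq_zero]
      have hd : addOrderOf b ∣ p ^ 2 := hB ▸ addOrderOf_dvd_natCard b
      obtain ⟨k, hk, hk'⟩ := (Nat.dvd_prime_pow hpp).1 hd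
      have : k ≠ 2 := by
        rintro rfl
        exact hc (isAddCyclic_of_addOrderOf_eq_card b (hk'.trans hB.symm))
      rw [hk']
      exact (pow_dvd_pow p (by omega : k ≤ 1)).trans (pow_one p).dvd
    let : Module (ZMod p) B := AddCommGroup.zmodModule hk
    rcases classify_elementary T hB with h | h
    · exact Or.inl h
    · exact Or.inr (Or.inr (Or.inl h))

end LeftBrace

/-! ### Functoriality of the semidirect product -/

namespace LeftBrace

section Congr

variable {A B : Type*} [AddCommGroup A] [AddCommGroup B] {q : ℕ}

/-- Isomorphic data give isomorphic semidirect products. -/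
def semidirectCongr {S : LeftBrace A} {T : LeftBrace B} (φ : S.Iso T) {χ : A → (ZMod q)ˣ}
    {χ' : B → (ZMod q)ˣ} (hχ : ∀ a b, χ (S.mul a b + a + b) = χ a * χ b)
    (hχ' : ∀ a b, χ' (T.mul a b + a + b) = χ' a * χ' b) (h : ∀ a, χ' (φ.toAddEquiv a) = χ a) :
    (S.semidirect q χ hχ).Iso (T.semidirect q χ' hχ') :=
  Iso.ofAddEquiv (φ.toAddEquiv.prodCongr (AddEquiv.refl _)) fun a b => by
    change (φ.toAddEquiv (S.mul a.1 b.1), ((χ a.1 : ZMod q) - 1) * b.2) =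
      (T.mul (φ.toAddEquiv a.1) (φ.toAddEquiv b.1),
        ((χ' (φ.toAddEquiv a.1) : ZMod q) - 1) * b.2)
    rw [φ.apply_mul, h]

/-- Every character of `S` corresponds to a character of an isomorphic brace. -/
theorem exists_semidirect_iso_of_iso {S : LeftBrace A} {T : LeftBrace B} (φ : S.Iso T)
    {χ : A → (ZMod q)ˣ} (hχ : ∀ a b, χ (S.mul a b + a + b) = χ a * χ b) :
    ∃ (χ' : B → (ZMod q)ˣ) (hχ' : ∀ a b, χ' (T.mul a b + a + b) = χ' a * χ' b),
      Nonempty ((S.semidirect q χ hχ).Iso (T.semidirect q χ' hχ')) := by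
  refine ⟨fun b => χ (φ.toAddEquiv.symm b), fun a b => ?_, ⟨semidirectCongr φ _ _ fun a => ?_⟩⟩
  · rw [← hχ]
    simp only [map_add]
    congr 3
    exact φ.symm.apply_mul a b
  · simp

/-- The identity isomorphism of a brace. -/
def Iso.refl (S : LeftBrace A) : S.Iso S := Iso.ofAddEquiv (AddEquiv.refl A) fun _ _ => rfl

end Congr

/-! ### Characters of the adjoint groups of the four braces of order p² -/

section Characters

variable {p q : ℕ} [Fact p.Prime]

theorem map_natCast_of_map_add {n : ℕ} {G : Type*} [Group G] {f : ZMod n → G} (h0 : f 0 = 1)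
    (h : ∀ a b, f (a + b) = f a * f b) (k : ℕ) : f k = f 1 ^ k := by
  induction k with
  | zero => simpa using h0
  | succ k ih => rw [Nat.cast_succ, h, ih, pow_succ]

theorem map_zero_of_char {A : Type*} [AddCommGroup A] {T : LeftBrace A} {G : Type*} [Group G]
    {χ : A → G} (hχ : ∀ a b, χ (T.mul a b + a + b) = χ a * χ b) : χ 0 = 1 := by
  have h := hχ 0 0
  simpa using h

theorem exists_iso_Tp2q {χ : ZMod (p ^ 2) → (ZMod q)ˣ}
    (hχ : ∀ a b, χ ((trivial (ZMod (p ^ 2))).mul a b + a + b) = χ a * χ b) :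
    ∃ ω, Nonempty (((trivial (ZMod (p ^ 2))).semidirect q χ hχ).Iso (Tp2q p q ω)) := by
  have h0 := map_zero_of_char hχ
  have h := map_natCast_of_map_add h0 fun a b => by simpa [trivial] using hχ a b
  have h1 : χ 1 ^ p ^ 2 = 1 := by rw [← h, ZMod.natCast_self, h0]
  refine ⟨⟨χ 1, (mem_rootsOfUnity _ _).2 h1⟩, ⟨semidirectCongr (Iso.refl _) _ _ fun a => ?_⟩⟩
  change χ 1 ^ (a.val : ℤ) = χ a
  rw [zpow_natCast, ← h, ZMod.natCast_zmod_val]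

theorem exists_iso_Tppq {χ : ZMod p × ZMod p → (ZMod q)ˣ}
    (hχ : ∀ a b, χ ((trivial (ZMod p × ZMod p)).mul a b + a + b) = χ a * χ b) :
    ∃ ω μ, Nonempty (((trivial (ZMod p × ZMod p)).semidirect q χ hχ).Iso (Tppq p q ω μ)) := by
  have h0 := map_zero_of_char hχ
  have hadd : ∀ a b, χ (a + b) = χ a * χ b := fun a b => by simpa [trivial] using hχ a b
  have hx := map_natCast_of_map_add (f := fun x : ZMod p => χ (x, 0)) h0 fun a b => by
    simp [← hadd]
  have hy := map_natCast_of_map_add (f := fun y : ZMod p => χ (0, y)) h0 fun a b => by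
    simp [← hadd]
  have hx1 : χ (1, 0) ^ p = 1 := by rw [← hx, ZMod.natCast_self]; exact h0
  have hy1 : χ (0, 1) ^ p = 1 := by rw [← hy, ZMod.natCast_self]; exact h0
  refine ⟨⟨_, (mem_rootsOfUnity _ _).2 hx1⟩, ⟨_, (mem_rootsOfUnity _ _).2 hy1⟩,
    ⟨semidirectCongr (Iso.refl _) _ _ fun a => ?_⟩⟩
  change χ (1, 0) ^ (a.1.val : ℤ) * χ (0, 1) ^ (a.2.val : ℤ) = χ a
  rw [zpow_natCast, zpow_natCast, ← hx, ← hy, ← hadd]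
  simp

/-- In the adjoint group (0, n)∘(0, 1) = (n, n + 1). By recursion χ(0, n) = χ(0, 1)^n χ(1, 0)^(-C(n,
2)), so the values at (1, 0) and (0, 1) determine χ. -/
theorem exists_iso_Bppq (hp : 2 < p) {χ : ZMod p × ZMod p → (ZMod q)ˣ}
    (hχ : ∀ a b, χ ((Bpp p).mul a b + a + b) = χ a * χ b) :
    ∃ ω μ, Nonempty (((Bpp p).semidirect q χ hχ).Iso (Bppq p q hp ω μ)) := by
  have h0 := map_zero_of_char hχ
  have hx := map_natCast_of_map_add (f := fun x : ZMod p => χ (x, 0)) h0 fun a b => by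
    simp [← hχ, Bpp]
  have hxy : ∀ x y, χ (x, y) = χ (x, 0) * χ (0, y) := fun x y => by simp [← hχ, Bpp]
  have hs : ∀ n : ℕ, χ (0, ((n + 1 : ℕ) : ZMod p)) * χ (1, 0) ^ n =
      χ (0, (n : ZMod p)) * χ (0, 1) := by
    intro n
    rw [← hx, mul_comm, ← hxy, ← hχ]
    simp [Bpp]
  have hC : ∀ n : ℕ, χ (0, (n : ZMod p)) * χ (1, 0) ^ n.choose 2 = χ (0, 1) ^ n := by
    intro n
    induction n with
    | zero => simpa [Prod.mk_zero_zero] using h0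
    | succ n ih =>
      rw [Nat.choose_succ_succ' n 1, Nat.choose_one_right, pow_add, ← mul_assoc, hs,
        pow_succ (χ _), ← ih, mul_right_comm]
  have hx1 : χ (1, 0) ^ p = 1 := by rw [← hx, ZMod.natCast_self]; exact h0
  have hy1 : χ (0, 1) ^ p = 1 := by
    -- Since p is odd, p divides C(p, 2), so the correction factor is trivial at n = p.
    obtain ⟨c, hc⟩ := (Fact.out : p.Prime).dvd_choose_self two_ne_zero hp
    rw [← hC, hc, pow_mul, hx1, one_pow, mul_one, ZMod.natCast_self]
    exact h0
  refine ⟨⟨_, (mem_rootsOfUnity _ _).2 hx1⟩, ⟨_, (mem_rootsOfUnity _ _).2 hy1⟩,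
    ⟨semidirectCongr (Iso.refl _) _ _ fun a => ?_⟩⟩
  change χ (1, 0) ^ ((a.1.val : ℤ) - (a.2.val.choose 2 : ℤ)) * χ (0, 1) ^ (a.2.val : ℤ) = χ a
  rw [zpow_sub, zpow_natCast, zpow_natCast, zpow_natCast, ← hC, ← hx, mul_comm (χ (0, _)),
    ← mul_assoc, inv_mul_cancel_right]
  simp only [ZMod.natCast_zmod_val, ← hxy]

/-- Here n∘1 = pn + n + 1, and multiples of p multiply to zero, so χ(n) = χ(1)^n χ(p)^(-C(n, 2)). At
n = p this yields χ(p) = χ(1)^p, which leaves χ(1) as the only parameter. -/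
theorem exists_iso_Bp2q (hp : 2 < p) {χ : ZMod (p ^ 2) → (ZMod q)ˣ}
    (hχ : ∀ a b, χ ((Bp2 p).mul a b + a + b) = χ a * χ b) :
    ∃ ω, Nonempty (((Bp2 p).semidirect q χ hχ).Iso (Bp2q p q hp ω)) := by
  have h0 := map_zero_of_char hχ
  have hpp := p_mul_p p
  have hadd : ∀ x y, χ (p * x + y) = χ (p * x) * χ y := by
    intro x y
    rw [← hχ]
    congr 1
    simp only [Bp2]
    linear_combination (-x * y) * hpp
  have hz : ∀ k : ℕ, χ (p * k) = χ p ^ k := by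
    intro k
    induction k with
    | zero => simpa using h0
    | succ k ih => rw [Nat.cast_succ, _root_.mul_add, mul_one, hadd, ih, pow_succ (χ _)]
  have hs : ∀ n : ℕ, χ ((n + 1 : ℕ) : ZMod (p ^ 2)) * χ p ^ n = χ n * χ 1 := by
    intro n
    rw [← hz, mul_comm, ← hadd, ← hχ]
    congr 1
    simp only [Bp2]
    push_cast
    ring
  have hC : ∀ n : ℕ, χ n * χ p ^ n.choose 2 = χ 1 ^ n := by
    intro n
    induction n with
    | zero => simpa using h0
    | succ n ih =>
      rw [Nat.choose_succ_succ' n 1, Nat.choose_one_right, pow_add, ← mul_assoc, hs,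
        pow_succ (χ _), ← ih, mul_right_comm]
  have hz1 : χ p ^ p = 1 := by rw [← hz, hpp, h0]
  have hz2 : χ p = χ 1 ^ p := by
    obtain ⟨c, hc⟩ := (Fact.out : p.Prime).dvd_choose_self two_ne_zero hp
    rw [← hC, hc, pow_mul, hz1, one_pow, mul_one]
  have h1 : χ 1 ^ p ^ 2 = 1 :=
    (congrArg (χ 1 ^ ·) (pow_two p)).trans (by rw [pow_mul, ← hz2, hz1])
  refine ⟨⟨χ 1, (mem_rootsOfUnity _ _).2 h1⟩, ⟨semidirectCongr (Iso.refl _) _ _ fun a => ?_⟩⟩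
  change χ 1 ^ ((a.val : ℤ) - p * (a.val.choose 2 : ℤ)) = χ a
  rw [zpow_sub, zpow_mul, zpow_natCast, zpow_natCast, zpow_natCast, ← hz2, ← hC,
    mul_inv_cancel_right, ZMod.natCast_zmod_val]

end Characters

/-- Every brace of order `p² q` belongs to one of the four families. -/
theorem exists_iso_family {p q : ℕ} [Fact p.Prime] [Fact q.Prime] (hp : 2 < p) (hpq : p < q)
    {A : Type*} [AddCommGroup A] (S : LeftBrace A) (hA : Nat.card A = p ^ 2 * q) :
    (∃ ω μ, Nonempty (S.Iso (Tppq p q ω μ))) ∨ (∃ ω, Nonempty (S.Iso (Tp2q p q ω))) ∨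
      (∃ ω μ, Nonempty (S.Iso (Bppq p q hp ω μ))) ∨ ∃ ω, Nonempty (S.Iso (Bp2q p q hp ω)) := by
  obtain ⟨H, T, χ, hχ, hH, ⟨i⟩⟩ := S.exists_iso_semidirect hp hpq hA
  rcases T.classify_card_sq hH with ⟨⟨φ⟩⟩ | ⟨⟨φ⟩⟩ | ⟨⟨φ⟩⟩ | ⟨⟨φ⟩⟩ <;>
    obtain ⟨χ', hχ', ⟨j⟩⟩ := exists_semidirect_iso_of_iso φ hχ
  · obtain ⟨ω, μ, ⟨k⟩⟩ := exists_iso_Tppq hχ'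
    exact Or.inl ⟨ω, μ, ⟨(i.trans j).trans k⟩⟩
  · obtain ⟨ω, ⟨k⟩⟩ := exists_iso_Tp2q hχ'
    exact Or.inr (Or.inl ⟨ω, ⟨(i.trans j).trans k⟩⟩)
  · obtain ⟨ω, μ, ⟨k⟩⟩ := exists_iso_Bppq hp hχ'
    exact Or.inr (Or.inr (Or.inl ⟨ω, μ, ⟨(i.trans j).trans k⟩⟩))
  · obtain ⟨ω, ⟨k⟩⟩ := exists_iso_Bp2q hp hχ'
    exact Or.inr (Or.inr (Or.inr ⟨ω, ⟨(i.trans j).trans k⟩⟩))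

end LeftBrace

/-! ### Rigidity: what an isomorphism does to the parameters -/

namespace LeftBrace

section Rigidity

variable {p q : ℕ} [Fact p.Prime] [Fact q.Prime] {A B : Type*} [AddCommGroup A] [AddCommGroup B]

/-- An isomorphism of semidirect products is induced by an isomorphism of the data. -/
theorem exists_iso_of_semidirect_iso (hpq : p ≠ q) (hA : Nat.card A = p ^ 2)
    (hB : Nat.card B = p ^ 2) {S : LeftBrace A} {T : LeftBrace B} {χ : A → (ZMod q)ˣ}
    {χ' : B → (ZMod q)ˣ} {hχ : ∀ a b, χ (S.mul a b + a + b) = χ a * χ b}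
    {hχ' : ∀ a b, χ' (T.mul a b + a + b) = χ' a * χ' b}
    (e : (S.semidirect q χ hχ).Iso (T.semidirect q χ' hχ')) :
    ∃ φ : S.Iso T, ∀ a, χ' (φ.toAddEquiv a) = χ a := by
  have h1 := map_inl_snd hpq hA (e.toAddEquiv : A × ZMod q →+ B × ZMod q)
  have h2 := map_inl_snd hpq hB (e.toAddEquiv.symm : B × ZMod q →+ A × ZMod q)
  have h3 := map_inr_fst hpq hB (e.toAddEquiv : A × ZMod q →+ B × ZMod q)
  simp only [AddMonoidHom.coe_coe] at h1 h2 h3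
  have hφ : ∀ a, e.toAddEquiv (a, 0) = ((e.toAddEquiv (a, 0)).1, 0) := fun a => Prod.ext rfl (h1 a)
  have hψ : ∀ b, e.toAddEquiv.symm (b, 0) = ((e.toAddEquiv.symm (b, 0)).1, 0) :=
    fun b => Prod.ext rfl (h2 b)
  let φ : A ≃+ B :=
    { toFun := fun a => (e.toAddEquiv (a, 0)).1
      invFun := fun b => (e.toAddEquiv.symm (b, 0)).1
      left_inv := fun a => by
        simp only
        rw [← hφ, e.toAddEquiv.symm_apply_apply]
      right_inv := fun b => by
        simp only
        rw [← hψ, e.toAddEquiv.apply_symm_apply]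
      map_add' := fun a b => by
        rw [← Prod.fst_add, ← map_add]
        simp }
  refine ⟨Iso.ofAddEquiv φ fun a b => ?_, fun a => ?_⟩
  · have h := congrArg Prod.fst (e.apply_mul (a, 0) (b, 0))
    simp only [semidirect, mul_zero] at h
    exact h
  -- The product (a, 0)·(0, 1) = (0, χ(a) - 1) displays the character; `e` rescales ℤ_q by a nonzero
  -- factor, which cancels.
  · have h := congrArg Prod.snd (e.apply_mul (a, 0) (0, 1))
    have h4 : (e.toAddEquiv (0, 1)).2 ≠ 0 := by
      intro h0
      have h5 : e.toAddEquiv (0, 1) = 0 := Prod.ext (h3 1) h0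
      rw [EmbeddingLike.map_eq_zero_iff] at h5
      simp at h5
    let ψ : ZMod q →+ ZMod q := ((AddMonoidHom.snd B (ZMod q)).comp
      (e.toAddEquiv : A × ZMod q →+ B × ZMod q)).comp (AddMonoidHom.inr A (ZMod q))
    have h6 : (e.toAddEquiv (0, (χ a : ZMod q) - 1)).2 =
        ((χ a : ZMod q) - 1) * (e.toAddEquiv (0, 1)).2 := by
      have := ZMod.map_smul ψ ((χ a : ZMod q) - 1) 1
      rwa [smul_eq_mul, smul_eq_mul, mul_one] at this
    simp only [semidirect, mul_zero_eq, mul_one] at h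
    rw [h6] at h
    have h7 := mul_right_cancel₀ h4 h
    ext
    exact (sub_left_injective h7).symm

theorem trivial_Tppq_of_iso (hpq : p ≠ q) {ω μ : rootsOfUnity p (ZMod q)}
    (e : (Tppq p q ω μ).Iso (Tppq p q 1 1)) : ω = 1 ∧ μ = 1 := by
  have : Fact (1 < p) := ⟨(Fact.out : p.Prime).one_lt⟩
  have hc : Nat.card (ZMod p × ZMod p) = p ^ 2 := by rw [Nat.card_prod, Nat.card_zmod, pow_two]
  obtain ⟨φ, hφ⟩ := exists_iso_of_semidirect_iso hpq hc hc e
  have h1 := hφ (1, 0)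
  have h2 := hφ (0, 1)
  simp only [OneMemClass.coe_one, one_zpow, mul_one, ZMod.val_one, ZMod.val_zero, Nat.cast_one,
    Nat.cast_zero, zpow_one, zpow_zero, one_mul] at h1 h2
  exact ⟨Subtype.ext h1.symm, Subtype.ext h2.symm⟩

theorem exists_pow_of_Tp2q_iso (hpq : p ≠ q) {ω ω' : rootsOfUnity (p ^ 2) (ZMod q)}
    (e : (Tp2q p q ω).Iso (Tp2q p q ω')) : ∃ k : ℕ, ω = ω' ^ k := by
  have : Fact (1 < p ^ 2) := ⟨Nat.one_lt_pow two_ne_zero (Fact.out : p.Prime).one_lt⟩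
  obtain ⟨φ, hφ⟩ := exists_iso_of_semidirect_iso hpq (Nat.card_zmod _) (Nat.card_zmod _) e
  have h := hφ 1
  simp only [ZMod.val_one, Nat.cast_one, zpow_one, zpow_natCast] at h
  exact ⟨_, Subtype.ext h.symm⟩

/-- Let (c, t) be the image of (0, 1). As (1, 0) = (0, 1)·(0, 1), it is sent to (t², 0), and
comparing characters at (1, 0) gives the square. At (0, 1) a further power of ω' enters, which
disappears for ω' = 1. -/
theorem exists_pow_of_Bppq_iso (hp : 2 < p) (hpq : p ≠ q) {ω μ ω' μ' : rootsOfUnity p (ZMod q)}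
    (e : (Bppq p q hp ω μ).Iso (Bppq p q hp ω' μ')) :
    ∃ t : ZMod p, ω = ω' ^ (t * t).val ∧ (ω' = 1 → μ = μ' ^ t.val) := by
  have : Fact (1 < p) := ⟨(Fact.out : p.Prime).one_lt⟩
  have hc : Nat.card (ZMod p × ZMod p) = p ^ 2 := by rw [Nat.card_prod, Nat.card_zmod, pow_two]
  obtain ⟨φ, hφ⟩ := exists_iso_of_semidirect_iso hpq hc hc e
  have h10 : φ.toAddEquiv (1, 0) =
      ((φ.toAddEquiv (0, 1)).2 * (φ.toAddEquiv (0, 1)).2, 0) := by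
    have h := φ.apply_mul (0, 1) (0, 1)
    simpa only [Bpp, mul_one] using h
  have h1 := hφ (1, 0)
  have h2 := hφ (0, 1)
  rw [h10] at h1
  refine ⟨(φ.toAddEquiv (0, 1)).2, ?_, ?_⟩
  · simp only [ZMod.val_zero, Nat.choose_zero_succ, Nat.cast_zero, sub_zero, zpow_zero, mul_one,
      ZMod.val_one, Nat.cast_one, zpow_one, zpow_natCast] at h1
    exact Subtype.ext h1.symm
  · rintro rfl
    have h3 : Nat.choose 1 2 = 0 := rfl
    simp only [OneMemClass.coe_one, one_zpow, one_mul, ZMod.val_zero, ZMod.val_one, h3,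
      Nat.cast_zero, sub_zero, zpow_zero, Nat.cast_one, zpow_one, zpow_natCast] at h2
    exact Subtype.ext h2.symm

theorem p_mul_choose (hp : 2 < p) {k : ℕ} (hk : (p : ZMod (p ^ 2)) * k = p) :
    (p : ZMod (p ^ 2)) * (k.choose 2 : ZMod (p ^ 2)) = 0 := by
  apply (isUnit_two hp 2 rfl).mul_left_cancel
  have h := two_mul_choose (R := ZMod (p ^ 2)) k
  linear_combination p * h + (k : ZMod (p ^ 2)) * hk

theorem p_mul_natCast_eq_iff (k : ℕ) : (p : ZMod (p ^ 2)) * k = p ↔ k ≡ 1 [MOD p] := by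
  have hp0 : p ≠ 0 := (Fact.out : p.Prime).ne_zero
  have h : (p : ZMod (p ^ 2)) * k = p ↔ p * k ≡ p * 1 [MOD p * p] := by
    rw [← pow_two, ← ZMod.natCast_eq_natCast_iff]
    push_cast
    rw [mul_one]
  rw [h]
  exact ⟨fun h => Nat.ModEq.mul_left_cancel' hp0 h, fun h => h.mul_left' p⟩

/-- The isomorphism is multiplication by a unit u, and preserving pxy at x = y = 1 means pu = pu²,
that is u ≡ 1 mod p. Then pC(u, 2) vanishes, so the character at u is just ω'^u. -/
theorem exists_pow_of_Bp2q_iso (hp : 2 < p) (hpq : p ≠ q) {ω ω' : rootsOfUnity (p ^ 2) (ZMod q)}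
    (e : (Bp2q p q hp ω).Iso (Bp2q p q hp ω')) : ∃ k : ℕ, k ≡ 1 [MOD p] ∧ ω = ω' ^ k := by
  have : Fact (1 < p ^ 2) := ⟨Nat.one_lt_pow two_ne_zero (Fact.out : p.Prime).one_lt⟩
  obtain ⟨φ, hφ⟩ := exists_iso_of_semidirect_iso hpq (Nat.card_zmod _) (Nat.card_zmod _) e
  have hlin : ∀ a, φ.toAddEquiv a = a * φ.toAddEquiv 1 := by
    intro a
    have h := ZMod.map_smul (φ.toAddEquiv : ZMod (p ^ 2) →+ ZMod (p ^ 2)) a 1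
    rwa [smul_eq_mul, smul_eq_mul, mul_one] at h
  set u := φ.toAddEquiv 1 with hu
  obtain ⟨w, hw⟩ := φ.toAddEquiv.surjective 1
  rw [hlin] at hw
  have hpu : (p : ZMod (p ^ 2)) * u = p := by
    have h := φ.apply_mul 1 1
    simp only [Bp2, mul_one] at h
    rw [← hu, hlin] at h
    linear_combination -w * h + (-p * u + p) * hw
  rw [← ZMod.natCast_zmod_val u] at hpu
  have h := hφ 1
  have h3 : Nat.choose 1 2 = 0 := rfl
  simp only [ZMod.val_one, h3, Nat.cast_zero, Nat.cast_one, mul_zero, sub_zero, zpow_one] at h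
  refine ⟨u.val, (p_mul_natCast_eq_iff _).1 hpu, Subtype.ext ?_⟩
  rw [← h, SubmonoidClass.coe_pow, ← zpow_natCast]
  apply zpow_congr
  push_cast
  rw [p_mul_choose hp hpu, sub_zero]

end Rigidity

/-! ### Normal forms: isomorphisms that simplify the parameters -/

section NormalForms

variable {p q : ℕ} [Fact p.Prime]

/-- The nonzero linear form ax + by can be taken as the first coordinate of an automorphism of ℤ_p².
-/
theorem nonempty_iso_Tppq (ω : rootsOfUnity p (ZMod q)) {a b : ZMod p} (h : a ≠ 0 ∨ b ≠ 0) :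
    Nonempty ((Tppq p q (ω ^ a.val) (ω ^ b.val)).Iso (Tppq p q ω 1)) := by
  obtain ⟨φ, hφ⟩ : ∃ φ : ZMod p × ZMod p ≃+ ZMod p × ZMod p, ∀ v, (φ v).1 = a * v.1 + b * v.2 := by
    by_cases ha : a = 0
    · have hb : b ≠ 0 := h.resolve_left (not_not.2 ha)
      exact ⟨{ toFun := fun v => (a * v.1 + b * v.2, v.1)
               invFun := fun v => (v.2, b⁻¹ * v.1)
               left_inv := fun v => by ext <;> simp [ha, hb]
               right_inv := fun v => by ext <;> simp [ha, hb]
               map_add' := fun v w => by ext <;> simp; ring }, fun v => rfl⟩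
    · exact ⟨{ toFun := fun v => (a * v.1 + b * v.2, v.2)
               invFun := fun v => (a⁻¹ * (v.1 - b * v.2), v.2)
               left_inv := fun v => by ext <;> simp [ha]
               right_inv := fun v => by ext <;> simp [ha]
               map_add' := fun v w => by ext <;> simp; ring }, fun v => rfl⟩
  refine ⟨semidirectCongr (Iso.ofAddEquiv φ fun _ _ => map_zero φ) _ _ fun v => ?_⟩
  change (ω : (ZMod q)ˣ) ^ ((φ v).1.val : ℤ) * ((1 : rootsOfUnity p (ZMod q)) : (ZMod q)ˣ) ^ _ = _
  rw [OneMemClass.coe_one, one_zpow, mul_one, SubmonoidClass.coe_pow, SubmonoidClass.coe_pow,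
    ← zpow_natCast, ← zpow_natCast, ← zpow_mul, ← zpow_mul, ← zpow_add]
  apply zpow_congr
  simp [hφ]

theorem isUnit_natCast_of_not_dvd {k : ℕ} (hk : ¬ p ∣ k) : IsUnit (k : ZMod (p ^ 2)) :=
  (ZMod.isUnit_iff_coprime _ _).2 (Nat.Coprime.pow_right 2
    (((Fact.out : p.Prime).coprime_iff_not_dvd.2 hk).symm))

theorem nonempty_iso_Tp2q (ω : rootsOfUnity (p ^ 2) (ZMod q)) {k : ℕ} (hk : ¬ p ∣ k) :
    Nonempty ((Tp2q p q (ω ^ k)).Iso (Tp2q p q ω)) := by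
  obtain ⟨u, hu⟩ := isUnit_natCast_of_not_dvd hk
  refine ⟨semidirectCongr (Iso.ofAddEquiv (AddAut.mulLeft u) fun _ _ => map_zero _) _ _
    fun a => ?_⟩
  change (ω : (ZMod q)ˣ) ^ (((u : ZMod (p ^ 2)) * a).val : ℤ) = _
  rw [SubmonoidClass.coe_pow, ← zpow_natCast, ← zpow_mul]
  apply zpow_congr
  simp [hu]

/-- The isomorphism is (x, y) ↦ (t²x + cy, ty). Matching exponents of ω gives `ha` from the
coefficients of x and y², and `hb` from the coefficient of y, doubled to clear the denominator of
C(y, 2). -/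
theorem nonempty_iso_Bppq (hp : 2 < p) (ω : rootsOfUnity p (ZMod q)) {a b a' b' t c : ZMod p}
    (ht : t ≠ 0) (ha : a = a' * t ^ 2) (hb : 2 * a' * c + a' * t + 2 * b' * t = a + 2 * b) :
    Nonempty ((Bppq p q hp (ω ^ a.val) (ω ^ b.val)).Iso
      (Bppq p q hp (ω ^ a'.val) (ω ^ b'.val))) := by
  let φ : ZMod p × ZMod p ≃+ ZMod p × ZMod p :=
    { toFun := fun v => (t ^ 2 * v.1 + c * v.2, t * v.2)
      invFun := fun v => ((t ^ 2)⁻¹ * (v.1 - c * (t⁻¹ * v.2)), t⁻¹ * v.2)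
      left_inv := fun v => by ext <;> simp [ht]
      right_inv := fun v => by ext <;> simp [ht]
      map_add' := fun v w => by ext <;> simp <;> ring }
  have hφ : ∀ v, φ v = (t ^ 2 * v.1 + c * v.2, t * v.2) := fun v => rfl
  refine ⟨semidirectCongr (Iso.ofAddEquiv φ fun v w => ?_) _ _ fun v => ?_⟩
  · rw [hφ, hφ, hφ]
    simp only [Bpp]
    ext <;> simp
    ring
  · change ((ω ^ a'.val : rootsOfUnity p (ZMod q)) : (ZMod q)ˣ) ^
        (((φ v).1.val : ℤ) - ((φ v).2.val.choose 2 : ℤ)) *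
      ((ω ^ b'.val : rootsOfUnity p (ZMod q)) : (ZMod q)ˣ) ^ ((φ v).2.val : ℤ) = _
    simp only [SubmonoidClass.coe_pow]
    simp only [← zpow_natCast, ← zpow_mul, ← zpow_add]
    apply zpow_congr
    apply (isUnit_two hp 1 (pow_one p).symm).mul_left_cancel
    have h1 := two_mul_choose (R := ZMod p) (φ v).2.val
    have h2 := two_mul_choose (R := ZMod p) v.2.val
    simp only [hφ, ZMod.natCast_zmod_val] at h1 h2
    simp only [hφ, Int.cast_sub, Int.cast_add, Int.cast_mul, Int.cast_natCast,
      ZMod.natCast_zmod_val]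
    linear_combination v.2 * hb - a' * h1 + a * h2 + (v.2 ^ 2 - 2 * v.1) * ha

/-- Multiplication by k preserves pxy because pk = p. -/
theorem nonempty_iso_Bp2q (hp : 2 < p) (ω : rootsOfUnity (p ^ 2) (ZMod q)) {k : ℕ}
    (hk : k ≡ 1 [MOD p]) : Nonempty ((Bp2q p q hp (ω ^ k)).Iso (Bp2q p q hp ω)) := by
  have hnd : ¬ p ∣ k := fun hd =>
    (Fact.out : p.Prime).one_lt.ne' (Nat.dvd_one.1 ((hk.dvd_iff dvd_rfl).1 hd))
  obtain ⟨u, hu⟩ := isUnit_natCast_of_not_dvd hnd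
  have hpu : (p : ZMod (p ^ 2)) * u = p := hu ▸ (p_mul_natCast_eq_iff k).2 hk
  refine ⟨semidirectCongr (Iso.ofAddEquiv (AddAut.mulLeft u) fun a b => ?_) _ _ fun a => ?_⟩
  · change (u : ZMod (p ^ 2)) * (p * a * b) = p * (u * a) * (u * b)
    linear_combination -u * a * b * hpu
  · change (ω : (ZMod q)ˣ) ^ ((((u : ZMod (p ^ 2)) * a).val : ℤ) -
      p * (((u : ZMod (p ^ 2)) * a).val.choose 2 : ℤ)) = _
    rw [SubmonoidClass.coe_pow, ← zpow_natCast, ← zpow_mul]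
    apply zpow_congr
    apply (isUnit_two hp 2 rfl).mul_left_cancel
    have h1 := two_mul_choose (R := ZMod (p ^ 2)) ((u : ZMod (p ^ 2)) * a).val
    have h2 := two_mul_choose (R := ZMod (p ^ 2)) a.val
    simp only [ZMod.natCast_zmod_val] at h1 h2
    simp only [Int.cast_sub, Int.cast_mul, Int.cast_natCast, ZMod.natCast_zmod_val, ← hu]
    linear_combination -p * h1 + u * p * h2 - u * a ^ 2 * hpu

end NormalForms

end LeftBrace

/-! ### Invariants separating the four families -/

namespace LeftBrace

section Invariants

variable {A B : Type*} [AddCommGroup A] [AddCommGroup B]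

/-- The additive group of a brace is killed by `n`. -/
def AddExponentDvd (_ : LeftBrace A) (n : ℕ) : Prop := ∀ x : A, n • x = 0

/-- The products in a brace are killed by `n`. -/
def ProductsKilledBy (S : LeftBrace A) (n : ℕ) : Prop := ∀ a b : A, n • S.mul a b = 0

theorem Iso.addExponentDvd_iff {S : LeftBrace A} {T : LeftBrace B} (e : S.Iso T) (n : ℕ) :
    S.AddExponentDvd n ↔ T.AddExponentDvd n := by
  constructor
  · intro h x
    apply e.toAddEquiv.symm.injective
    rw [map_nsmul, h, map_zero]
  · intro h x
    apply e.toAddEquiv.injective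
    rw [map_nsmul, h, map_zero]

theorem Iso.productsKilledBy_of {S : LeftBrace A} {T : LeftBrace B} (e : S.Iso T) {n : ℕ}
    (h : S.ProductsKilledBy n) : T.ProductsKilledBy n := fun a b => by
  apply e.toAddEquiv.symm.injective
  rw [map_nsmul, map_zero]
  have h1 := h (e.toAddEquiv.symm a) (e.toAddEquiv.symm b)
  exact (congrArg (n • ·) (e.symm.apply_mul a b)).trans h1

theorem Iso.productsKilledBy_iff {S : LeftBrace A} {T : LeftBrace B} (e : S.Iso T) (n : ℕ) :
    S.ProductsKilledBy n ↔ T.ProductsKilledBy n :=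
  ⟨e.productsKilledBy_of, e.symm.productsKilledBy_of⟩

variable {p q : ℕ} [Fact p.Prime] [Fact q.Prime]

theorem addExponentDvd_zmod_prod (S : LeftBrace ((ZMod p × ZMod p) × ZMod q)) :
    S.AddExponentDvd (p * q) := fun x => by
  ext <;> simp

theorem natCast_ne_zero_sq (hpq : p ≠ q) : (q : ZMod (p ^ 2)) * p ≠ 0 := by
  intro h
  rw [← Nat.cast_mul, ZMod.natCast_eq_zero_iff, pow_two,
    Nat.mul_dvd_mul_iff_right (Fact.out : p.Prime).pos] at h
  exact hpq ((Nat.prime_dvd_prime_iff_eq Fact.out Fact.out).1 h)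

theorem not_addExponentDvd_zmod_sq (hpq : p ≠ q) (S : LeftBrace (ZMod (p ^ 2) × ZMod q)) :
    ¬ S.AddExponentDvd (p * q) := fun h => by
  have h1 := congrArg Prod.fst (h (1, 0))
  rw [Prod.smul_fst, nsmul_eq_mul, Nat.cast_mul, mul_one, mul_comm] at h1
  exact natCast_ne_zero_sq hpq h1

theorem productsKilledBy_Tppq (ω μ : rootsOfUnity p (ZMod q)) :
    (Tppq p q ω μ).ProductsKilledBy q := fun a b => by
  ext <;> simp [Tppq, semidirect, trivial]

theorem productsKilledBy_Tp2q (ω : rootsOfUnity (p ^ 2) (ZMod q)) :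
    (Tp2q p q ω).ProductsKilledBy q := fun a b => by
  ext <;> simp [Tp2q, semidirect, trivial]

theorem not_productsKilledBy_Bppq (hp : 2 < p) (hpq : p ≠ q) (ω μ : rootsOfUnity p (ZMod q)) :
    ¬ (Bppq p q hp ω μ).ProductsKilledBy q := fun h => by
  have h1 : q • ((1 : ZMod p) * 1) = 0 :=
    congrArg (fun x => x.1.1) (h (((0 : ZMod p), (1 : ZMod p)), (0 : ZMod q)) ((0, 1), 0))
  rw [nsmul_eq_mul, mul_one, mul_one, ZMod.natCast_eq_zero_iff] at h1
  exact hpq ((Nat.prime_dvd_prime_iff_eq Fact.out Fact.out).1 h1)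

theorem not_productsKilledBy_Bp2q (hp : 2 < p) (hpq : p ≠ q) (ω : rootsOfUnity (p ^ 2) (ZMod q)) :
    ¬ (Bp2q p q hp ω).ProductsKilledBy q := fun h => by
  have h1 : q • ((p : ZMod (p ^ 2)) * 1 * 1) = 0 :=
    congrArg (fun x => x.1) (h ((1 : ZMod (p ^ 2)), (0 : ZMod q)) (1, 0))
  rw [nsmul_eq_mul, mul_one, mul_one] at h1
  exact natCast_ne_zero_sq hpq h1

end Invariants

end LeftBrace

/-! ### Roots of unity and squares in finite prime fields -/

section Roots

variable {p q : ℕ}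

theorem rootsOfUnity_pow_eq_one {n : ℕ} (ω : rootsOfUnity n (ZMod q)) : ω ^ n = 1 :=
  Subtype.ext ((mem_rootsOfUnity _ _).1 ω.2)

theorem orderOf_dvd_sub_one [Fact q.Prime] {n : ℕ} (ω : rootsOfUnity n (ZMod q)) :
    orderOf ω ∣ q - 1 :=
  orderOf_dvd_of_pow_eq_one (Subtype.ext (ZMod.units_pow_card_sub_one_eq_one q _))

theorem dvd_sub_one_of_ne_one [Fact p.Prime] [Fact q.Prime]
    {ω : rootsOfUnity p (ZMod q)} (h : ω ≠ 1) : p ∣ q - 1 :=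
  orderOf_eq_prime (rootsOfUnity_pow_eq_one ω) h ▸ orderOf_dvd_sub_one ω

theorem sq_dvd_sub_one_of_pow_ne_one [Fact p.Prime] [Fact q.Prime]
    {ω : rootsOfUnity (p ^ 2) (ZMod q)} (h : ω ^ p ≠ 1) :
    p ^ 2 ∣ q - 1 := by
  have h1 : orderOf ω = p ^ (1 + 1) :=
    orderOf_eq_prime_pow (by rwa [pow_one]) (rootsOfUnity_pow_eq_one ω)
  rw [← show orderOf ω = p ^ 2 from h1]
  exact orderOf_dvd_sub_one ω

theorem exists_eq_pow [Fact q.Prime] {n : ℕ} [NeZero n] {ζ : rootsOfUnity n (ZMod q)}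
    (hζ : IsPrimitiveRoot ζ n)
    (ξ : rootsOfUnity n (ZMod q)) : ∃ i < n, ξ = ζ ^ i := by
  have h1 : IsPrimitiveRoot ((ζ : (ZMod q)ˣ) : ZMod q) n :=
    IsPrimitiveRoot.coe_units_iff.2 (IsPrimitiveRoot.coe_submonoidClass_iff.2 hζ)
  obtain ⟨i, hi, h⟩ := h1.eq_pow_of_pow_eq_one (ξ := ((ξ : (ZMod q)ˣ) : ZMod q)) (by
    rw [← Units.val_pow_eq_pow_val, ← SubmonoidClass.coe_pow, rootsOfUnity_pow_eq_one]
    simp)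
  refine ⟨i, hi, Subtype.ext (Units.ext ?_)⟩
  rw [← h]
  simp

theorem exists_eq_pow_val [Fact q.Prime] {n : ℕ} [NeZero n] {ζ : rootsOfUnity n (ZMod q)}
    (hζ : IsPrimitiveRoot ζ n) (ξ : rootsOfUnity n (ZMod q)) : ∃ a : ZMod n, ξ = ζ ^ a.val := by
  obtain ⟨i, hi, h⟩ := exists_eq_pow hζ ξ
  exact ⟨i, by rw [ZMod.val_natCast_of_lt hi, h]⟩

theorem pow_val_inj {n : ℕ} [NeZero n] {ζ : rootsOfUnity n (ZMod q)} (hζ : IsPrimitiveRoot ζ n)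
    {a b : ZMod n} (h : ζ ^ a.val = ζ ^ b.val) : a = b :=
  ZMod.val_injective n (hζ.pow_inj (ZMod.val_lt a) (ZMod.val_lt b) h)

theorem pow_val_mul {n : ℕ} (ζ : rootsOfUnity n (ZMod q)) (a b : ZMod n) :
    (ζ ^ a.val) ^ b.val = ζ ^ (a * b).val := by
  rw [← pow_mul, ZMod.val_mul]
  exact pow_eq_pow_mod _ (rootsOfUnity_pow_eq_one ζ)

theorem exists_mul_sq_of_not_isSquare [Fact p.Prime] {η a : ZMod p} (hη : ¬ IsSquare η)
    (ha : a ≠ 0) : ∃ s : ZMod p, (s = 1 ∨ s = η) ∧ ∃ t ≠ 0, a = s * t ^ 2 := by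
  by_cases hs : IsSquare a
  · obtain ⟨t, rfl⟩ := hs
    exact ⟨1, Or.inl rfl, t, fun h => ha (by simp [h]), by ring⟩
  · have hη0 : η ≠ 0 := fun h => hη (h ▸ IsSquare.zero)
    -- By Euler's criterion both non-squares have symbol -1, so their product has symbol 1.
    obtain ⟨t, ht⟩ : IsSquare (a * η) := by
      rw [ZMod.euler_criterion p (mul_ne_zero ha hη0), mul_pow,
        (ZMod.pow_div_two_eq_neg_one_or_one p ha).resolve_left
          fun h => hs ((ZMod.euler_criterion p ha).2 h),
        (ZMod.pow_div_two_eq_neg_one_or_one p hη0).resolve_left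
          fun h => hη ((ZMod.euler_criterion p hη0).2 h)]
      ring
    have ht0 : t ≠ 0 := by
      rintro rfl
      simp [ha, hη0] at ht
    refine ⟨η, Or.inr rfl, t / η, div_ne_zero ht0 hη0, ?_⟩
    field_simp
    linear_combination ht

theorem rootIncl_injective : Function.Injective (rootIncl p q) :=
  Subgroup.inclusion_injective _

theorem exists_rootIncl_eq {ω : rootsOfUnity (p ^ 2) (ZMod q)} (h : ω ^ p = 1) :
    ∃ ω', ω = rootIncl p q ω' :=
  ⟨⟨ω.1, (mem_rootsOfUnity _ _).2 (congrArg Subtype.val h)⟩, rfl⟩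

end Roots

/-! ### The family of a list position as an isomorphism invariant -/

namespace FineIndex

open LeftBrace

variable {p q : ℕ} [Fact p.Prime] [Fact q.Prime] (hp : 2 < p) (hpq : p < q)
  (ω : rootsOfUnity p (ZMod q)) (ω' : rootsOfUnity (p ^ 2) (ZMod q)) (η : ZMod p)

/-- The family of a position in the list: whether the additive group is `ℤ_p² ⊕ ℤ_q`, and whether
the Sylow `p`-subgroup carries the trivial brace. -/
def family : FineIndex p q → Bool × Bool
  | Tpp_one => (true, true)
  | Tp2_one => (false, true)
  | Bpp_one => (true, false)
  | Bp2_one => (false, false)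
  | Tpp_root _ => (true, true)
  | Tp2_root _ => (false, true)
  | Bpp_one_root _ => (true, false)
  | Bpp_root_one _ => (true, false)
  | Bpp_nonresidue _ => (true, false)
  | Bp2_root _ _ => (false, false)
  | Tp2_root2 _ => (false, true)
  | Bp2_root2 _ _ => (false, false)

/-- The integer pq kills ℤ_p² ⊕ ℤ_q but not ℤ_{p²} ⊕ ℤ_q. The integer q kills all products exactly
when they lie in ℤ_q, that is, when the p-part is a trivial brace. -/
theorem family_eq_iff (hpq : p ≠ q) (k : FineIndex p q) :
    ((fineList p q hp ω ω' η k).brace.AddExponentDvd (p * q) ↔ k.family.1 = true) ∧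
      ((fineList p q hp ω ω' η k).brace.ProductsKilledBy q ↔ k.family.2 = true) := by
  constructor <;> cases k <;>
    first
    | exact iff_of_true (addExponentDvd_zmod_prod _) rfl
    | exact iff_of_false (not_addExponentDvd_zmod_sq hpq _) Bool.false_ne_true
    | exact iff_of_true (productsKilledBy_Tppq _ _) rfl
    | exact iff_of_true (productsKilledBy_Tp2q _) rfl
    | exact iff_of_false (not_productsKilledBy_Bppq hp hpq _ _) Bool.false_ne_true
    | exact iff_of_false (not_productsKilledBy_Bp2q hp hpq _) Bool.false_ne_true

theorem family_eq_of_iso (hpq : p ≠ q) {k l : FineIndex p q}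
    (e : (fineList p q hp ω ω' η k).brace.Iso (fineList p q hp ω ω' η l).brace) :
    k.family = l.family := by
  have hk := family_eq_iff hp ω ω' η hpq k
  have hl := family_eq_iff hp ω ω' η hpq l
  rw [e.addExponentDvd_iff, e.productsKilledBy_iff] at hk
  exact Prod.ext (Bool.eq_iff_iff.2 (hk.1.symm.trans hl.1))
    (Bool.eq_iff_iff.2 (hk.2.symm.trans hl.2))

end FineIndex

theorem not_dvd_of_mem_Icc {p i : ℕ} (hi : i ∈ Finset.Icc 1 (p - 1)) : ¬ p ∣ i := fun h => by
  have := Nat.le_of_dvd (Finset.mem_Icc.1 hi).1 h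
  have := (Finset.mem_Icc.1 hi).1
  have := (Finset.mem_Icc.1 hi).2
  omega

/-! ### Completeness and irredundancy of the list -/

namespace LeftBrace

variable {p q : ℕ} [Fact p.Prime] [Fact q.Prime] {ω : rootsOfUnity p (ZMod q)}
  {ω' : rootsOfUnity (p ^ 2) (ZMod q)} {η : ZMod p}

theorem exists_fineList_of_Tppq (hp : 2 < p) (hω : p ∣ q - 1 → IsPrimitiveRoot ω p)
    (α β : rootsOfUnity p (ZMod q)) :
    ∃ k, Nonempty ((Tppq p q α β).Iso (fineList p q hp ω ω' η k).brace) := by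
  by_cases h1 : α = 1 ∧ β = 1
  · obtain ⟨rfl, rfl⟩ := h1
    exact ⟨.Tpp_one, ⟨Iso.refl _⟩⟩
  · have h : p ∣ q - 1 := by
      by_cases hα : α = 1
      · exact dvd_sub_one_of_ne_one fun hβ => h1 ⟨hα, hβ⟩
      · exact dvd_sub_one_of_ne_one hα
    obtain ⟨a, rfl⟩ := exists_eq_pow_val (hω h) α
    obtain ⟨b, rfl⟩ := exists_eq_pow_val (hω h) β
    refine ⟨.Tpp_root h, nonempty_iso_Tppq ω ?_⟩
    by_contra! hab
    exact h1 (by simp [hab.1, hab.2])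

theorem exists_eq_rootIncl_pow (hω : p ∣ q - 1 → IsPrimitiveRoot ω p)
    {α : rootsOfUnity (p ^ 2) (ZMod q)} (h1 : α ≠ 1) (hp1 : α ^ p = 1) :
    p ∣ q - 1 ∧ ∃ i ∈ Finset.Icc 1 (p - 1), α = rootIncl p q (ω ^ i) := by
  obtain ⟨β, rfl⟩ := exists_rootIncl_eq hp1
  have h : p ∣ q - 1 := dvd_sub_one_of_ne_one fun hβ : β = 1 => h1 (by rw [hβ, map_one])
  obtain ⟨i, hi, rfl⟩ := exists_eq_pow (hω h) β
  refine ⟨h, i, Finset.mem_Icc.2 ⟨Nat.one_le_iff_ne_zero.2 ?_, by omega⟩, rfl⟩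
  rintro rfl
  simp at h1

theorem exists_pow_not_dvd_of_pow_ne_one (hω' : p ^ 2 ∣ q - 1 → IsPrimitiveRoot ω' (p ^ 2))
    {α : rootsOfUnity (p ^ 2) (ZMod q)} (hp1 : α ^ p ≠ 1) :
    p ^ 2 ∣ q - 1 ∧ ∃ i, ¬ p ∣ i ∧ α = ω' ^ i := by
  have h := sq_dvd_sub_one_of_pow_ne_one hp1
  obtain ⟨i, hi, rfl⟩ := exists_eq_pow (hω' h) α
  refine ⟨h, i, ?_, rfl⟩
  rintro ⟨j, rfl⟩
  apply hp1
  rw [← pow_mul, show p * j * p = p ^ 2 * j by ring, pow_mul, rootsOfUnity_pow_eq_one, one_pow]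

theorem exists_fineList_of_Tp2q (hp : 2 < p) (hω : p ∣ q - 1 → IsPrimitiveRoot ω p)
    (hω' : p ^ 2 ∣ q - 1 → IsPrimitiveRoot ω' (p ^ 2)) (α : rootsOfUnity (p ^ 2) (ZMod q)) :
    ∃ k, Nonempty ((Tp2q p q α).Iso (fineList p q hp ω ω' η k).brace) := by
  by_cases h1 : α = 1
  · subst h1
    exact ⟨.Tp2_one, ⟨Iso.refl _⟩⟩
  by_cases hp1 : α ^ p = 1
  · obtain ⟨h, i, hi, rfl⟩ := exists_eq_rootIncl_pow hω h1 hp1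
    rw [map_pow]
    exact ⟨.Tp2_root h, nonempty_iso_Tp2q _ (not_dvd_of_mem_Icc hi)⟩
  · obtain ⟨h, i, hi, rfl⟩ := exists_pow_not_dvd_of_pow_ne_one hω' hp1
    exact ⟨.Tp2_root2 h, nonempty_iso_Tp2q _ hi⟩

theorem exists_fineList_of_Bp2q (hp : 2 < p) (hω : p ∣ q - 1 → IsPrimitiveRoot ω p)
    (hω' : p ^ 2 ∣ q - 1 → IsPrimitiveRoot ω' (p ^ 2)) (α : rootsOfUnity (p ^ 2) (ZMod q)) :
    ∃ k, Nonempty ((Bp2q p q hp α).Iso (fineList p q hp ω ω' η k).brace) := by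
  have hpp : p.Prime := Fact.out
  by_cases h1 : α = 1
  · subst h1
    exact ⟨.Bp2_one, ⟨Iso.refl _⟩⟩
  by_cases hp1 : α ^ p = 1
  · obtain ⟨h, i, hi, rfl⟩ := exists_eq_rootIncl_pow hω h1 hp1
    exact ⟨.Bp2_root h ⟨i, hi⟩, ⟨Iso.refl _⟩⟩
  · obtain ⟨h, i, hi, rfl⟩ := exists_pow_not_dvd_of_pow_ne_one hω' hp1
    have hj0 : i % p ≠ 0 := fun h0 => hi (Nat.dvd_of_mod_eq_zero h0)
    have hj : i % p ∈ Finset.Icc 1 (p - 1) := by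
      have := Nat.mod_lt i hpp.pos
      exact Finset.mem_Icc.2 ⟨by omega, by omega⟩
    obtain ⟨u, hu⟩ := isUnit_natCast_of_not_dvd (not_dvd_of_mem_Icc hj)
    -- This m is the quotient of i by its residue i % p modulo p²; it is 1 modulo p, so i may be
    -- replaced by i % p.
    set m : ZMod (p ^ 2) := (i : ZMod (p ^ 2)) * ((u⁻¹ : (ZMod (p ^ 2))ˣ) : ZMod (p ^ 2)) with hm
    have hmi : i % p * m.val ≡ i [MOD p ^ 2] := by
      rw [← ZMod.natCast_eq_natCast_iff, Nat.cast_mul, ← hu, ZMod.natCast_zmod_val, hm,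
        mul_left_comm, Units.mul_inv, mul_one]
    have hm1 : m.val ≡ 1 [MOD p] := by
      have h2 : i % p * m.val ≡ i % p * 1 [MOD p] := by
        rw [mul_one]
        exact (hmi.of_dvd (dvd_pow_self p two_ne_zero)).trans (Nat.mod_modEq i p).symm
      exact Nat.ModEq.cancel_left_of_coprime
        (hpp.coprime_iff_not_dvd.2 (not_dvd_of_mem_Icc hj)) h2
    have he : ω' ^ i = (ω' ^ (i % p)) ^ m.val := by
      rw [← pow_mul, pow_eq_pow_iff_modEq]
      exact hmi.symm.of_dvd (orderOf_dvd_of_pow_eq_one (rootsOfUnity_pow_eq_one ω'))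
    rw [he]
    exact ⟨.Bp2_root2 h ⟨i % p, hj⟩, nonempty_iso_Bp2q hp _ hm1⟩

theorem exists_fineList_of_Bppq (hp : 2 < p) (hω : p ∣ q - 1 → IsPrimitiveRoot ω p)
    (hη : ¬ IsSquare η) (α β : rootsOfUnity p (ZMod q)) :
    ∃ k, Nonempty ((Bppq p q hp α β).Iso (fineList p q hp ω ω' η k).brace) := by
  have : Fact (1 < p) := ⟨(Fact.out : p.Prime).one_lt⟩
  have h2 : (2 : ZMod p) ≠ 0 := (isUnit_two hp 1 (pow_one p).symm).ne_zero
  by_cases hα : α = 1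
  · subst hα
    by_cases hβ : β = 1
    · subst hβ
      exact ⟨.Bpp_one, ⟨Iso.refl _⟩⟩
    · have h := dvd_sub_one_of_ne_one hβ
      obtain ⟨b, rfl⟩ := exists_eq_pow_val (hω h) β
      have hb : b ≠ 0 := by
        rintro rfl
        simp at hβ
      have := nonempty_iso_Bppq hp ω (a := 0) (a' := 0) (b := b) (b' := 1) (c := 0) hb
        (by ring) (by ring)
      rw [ZMod.val_zero, ZMod.val_one, pow_zero, pow_one] at this
      exact ⟨.Bpp_one_root h, this⟩
  · have h := dvd_sub_one_of_ne_one hα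
    obtain ⟨a, rfl⟩ := exists_eq_pow_val (hω h) α
    obtain ⟨b, rfl⟩ := exists_eq_pow_val (hω h) β
    have ha : a ≠ 0 := by
      rintro rfl
      simp at hα
    obtain ⟨s, hs, t, ht, hst⟩ := exists_mul_sq_of_not_isSquare hη ha
    have hs0 : s ≠ 0 := by
      rintro rfl
      simp [ha] at hst
    -- The shear parameter c solves the linear condition for b' = 0, which is possible because 2s is
    -- invertible.
    have := nonempty_iso_Bppq hp ω (a := a) (a' := s) (b := b) (b' := 0)
      (c := (a + 2 * b - s * t) / (2 * s)) ht hst (by field_simp; ring)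
    rw [ZMod.val_zero, pow_zero] at this
    rcases hs with rfl | rfl
    · rw [ZMod.val_one, pow_one] at this
      exact ⟨.Bpp_root_one h, this⟩
    · exact ⟨.Bpp_nonresidue h, this⟩

/-- Every brace of order `p² q` is isomorphic to a member of the list. -/
theorem exists_fineList (hp : 2 < p) (hpq : p < q) (hω : p ∣ q - 1 → IsPrimitiveRoot ω p)
    (hω' : p ^ 2 ∣ q - 1 → IsPrimitiveRoot ω' (p ^ 2)) (hη : ¬ IsSquare η)
    {A : Type*} [AddCommGroup A] (S : LeftBrace A) (hA : Nat.card A = p ^ 2 * q) :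
    ∃ k, Nonempty (S.Iso (fineList p q hp ω ω' η k).brace) := by
  rcases S.exists_iso_family hp hpq hA with ⟨α, β, ⟨i⟩⟩ | ⟨α, ⟨i⟩⟩ | ⟨α, β, ⟨i⟩⟩ | ⟨α, ⟨i⟩⟩
  · obtain ⟨k, ⟨j⟩⟩ := exists_fineList_of_Tppq (ω' := ω') (η := η) hp hω α β
    exact ⟨k, ⟨i.trans j⟩⟩
  · obtain ⟨k, ⟨j⟩⟩ := exists_fineList_of_Tp2q (η := η) hp hω hω' α
    exact ⟨k, ⟨i.trans j⟩⟩
  · obtain ⟨k, ⟨j⟩⟩ := exists_fineList_of_Bppq (ω' := ω') hp hω hη α β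
    exact ⟨k, ⟨i.trans j⟩⟩
  · obtain ⟨k, ⟨j⟩⟩ := exists_fineList_of_Bp2q (η := η) hp hω hω' α
    exact ⟨k, ⟨i.trans j⟩⟩

/-- Each of the two roots is a power of the other. -/
theorem eq_one_iff_of_Tp2q_iso (hpq : p ≠ q) {α β : rootsOfUnity (p ^ 2) (ZMod q)}
    (e : (Tp2q p q α).Iso (Tp2q p q β)) (n : ℕ) : α ^ n = 1 ↔ β ^ n = 1 := by
  obtain ⟨k, hk⟩ := exists_pow_of_Tp2q_iso hpq e
  obtain ⟨l, hl⟩ := exists_pow_of_Tp2q_iso hpq e.symm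
  constructor <;> intro h
  · rw [hl, ← pow_mul, mul_comm, pow_mul, h, one_pow]
  · rw [hk, ← pow_mul, mul_comm, pow_mul, h, one_pow]

theorem eq_one_iff_of_Bp2q_iso (hp : 2 < p) (hpq : p ≠ q) {α β : rootsOfUnity (p ^ 2) (ZMod q)}
    (e : (Bp2q p q hp α).Iso (Bp2q p q hp β)) (n : ℕ) : α ^ n = 1 ↔ β ^ n = 1 := by
  obtain ⟨k, -, hk⟩ := exists_pow_of_Bp2q_iso hp hpq e
  obtain ⟨l, -, hl⟩ := exists_pow_of_Bp2q_iso hp hpq e.symm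
  constructor <;> intro h
  · rw [hl, ← pow_mul, mul_comm, pow_mul, h, one_pow]
  · rw [hk, ← pow_mul, mul_comm, pow_mul, h, one_pow]

theorem left_eq_one_of_Bppq_iso (hp : 2 < p) (hpq : p ≠ q) {α β α' β' : rootsOfUnity p (ZMod q)}
    (e : (Bppq p q hp α β).Iso (Bppq p q hp α' β')) (h : α' = 1) :
    α = 1 ∧ (β' = 1 → β = 1) := by
  obtain ⟨t, h1, h2⟩ := exists_pow_of_Bppq_iso hp hpq e
  exact ⟨by rw [h1, h, one_pow], fun h3 => by rw [h2 h, h3, one_pow]⟩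

/-- The exponents agree modulo n, hence modulo p, where k disappears; representatives between 1 and
p - 1 are unique. -/
theorem eq_of_pow_eq_pow_pow {G : Type*} [CommGroup G] {ζ : G} {n i j k : ℕ}
    (hζ : IsPrimitiveRoot ζ n) (hn : p ∣ n) (hi : i ∈ Finset.Icc 1 (p - 1))
    (hj : j ∈ Finset.Icc 1 (p - 1)) (hk : k ≡ 1 [MOD p]) (h : ζ ^ i = (ζ ^ j) ^ k) : i = j := by
  have hp0 : 0 < p := (Fact.out : p.Prime).pos
  rw [← pow_mul, pow_eq_pow_iff_modEq, ← hζ.eq_orderOf] at h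
  have h1 := (h.of_dvd hn).trans (hk.mul_left j)
  rw [mul_one] at h1
  rw [Finset.mem_Icc] at hi hj
  exact h1.eq_of_lt_of_lt (by omega) (by omega)

/-- Members of the list at different positions are not isomorphic. -/
theorem fineList_injective (hp : 2 < p) (hpq : p < q) (hω : p ∣ q - 1 → IsPrimitiveRoot ω p)
    (hω' : p ^ 2 ∣ q - 1 → IsPrimitiveRoot ω' (p ^ 2)) (hη : ¬ IsSquare η) {k l : FineIndex p q}
    (e : (fineList p q hp ω ω' η k).brace.Iso (fineList p q hp ω ω' η l).brace) : k = l := by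
  have hpp : p.Prime := Fact.out
  have : Fact (1 < p) := ⟨hpp.one_lt⟩
  have hfam := FineIndex.family_eq_of_iso hp ω ω' η hpq.ne e
  have hη0 : η ≠ 0 := fun h => hη (h ▸ IsSquare.zero)
  have hω1 (h : p ∣ q - 1) : ω ≠ 1 := (hω h).ne_one hpp.one_lt
  have hωη (h : p ∣ q - 1) : ω ^ η.val ≠ 1 := fun h1 => hη0 (pow_val_inj (hω h) (by simpa using h1))
  -- Such a relation gives 1 = ηt², which makes η the square of t⁻¹.
  have hη1 (h : p ∣ q - 1) (t : ZMod p) (h1 : ω = (ω ^ η.val) ^ (t * t).val) : False := by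
    rw [pow_val_mul] at h1
    have h2 : 1 = η * (t * t) := pow_val_inj (hω h) (by rwa [ZMod.val_one, pow_one])
    have ht : t ≠ 0 := by
      rintro rfl
      simp at h2
    refine hη ⟨t⁻¹, ?_⟩
    field_simp
    linear_combination -h2
  have hr (α : rootsOfUnity p (ZMod q)) : rootIncl p q α ^ p = 1 := by
    rw [← map_pow, rootsOfUnity_pow_eq_one, map_one]
  have hr1 {α : rootsOfUnity p (ZMod q)} (h : α ≠ 1) : rootIncl p q α ≠ 1 := fun h1 =>
    h (rootIncl_injective (h1.trans (map_one _).symm))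
  have hi1 (h : p ∣ q - 1) {i : ℕ} (hi : i ∈ Finset.Icc 1 (p - 1)) : ω ^ i ≠ 1 := fun h1 =>
    not_dvd_of_mem_Icc hi ((hω h).dvd_of_pow_eq_one i h1)
  have hi2 (h : p ^ 2 ∣ q - 1) {i : ℕ} (hi : ¬ p ∣ i) : (ω' ^ i) ^ p ≠ 1 := fun h1 => by
    rw [← pow_mul] at h1
    have h2 := (hω' h).dvd_of_pow_eq_one _ h1
    rw [pow_two, Nat.mul_dvd_mul_iff_right hpp.pos] at h2
    exact hi h2
  have hw (h : p ^ 2 ∣ q - 1) : ω' ^ p ≠ 1 := by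
    simpa using hi2 h (i := 1) (Nat.dvd_one.not.2 hpp.one_lt.ne')
  have hT2 {α β : rootsOfUnity (p ^ 2) (ZMod q)} (e : (Tp2q p q α).Iso (Tp2q p q β)) :
      (α = 1 ↔ β = 1) ∧ (α ^ p = 1 ↔ β ^ p = 1) :=
    ⟨by simpa using eq_one_iff_of_Tp2q_iso hpq.ne e 1, eq_one_iff_of_Tp2q_iso hpq.ne e p⟩
  have hB2 {α β : rootsOfUnity (p ^ 2) (ZMod q)} (e : (Bp2q p q hp α).Iso (Bp2q p q hp β)) :
      (α = 1 ↔ β = 1) ∧ (α ^ p = 1 ↔ β ^ p = 1) :=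
    ⟨by simpa using eq_one_iff_of_Bp2q_iso hp hpq.ne e 1, eq_one_iff_of_Bp2q_iso hp hpq.ne e p⟩
  have hB {α β α' β' : rootsOfUnity p (ZMod q)}
      (e : (Bppq p q hp α β).Iso (Bppq p q hp α' β')) :=
    left_eq_one_of_Bppq_iso hp hpq.ne e
  -- Positions in different families are excluded by `hfam`. Within a family, triviality of roots or
  -- of their p-th powers decides, except for the non-residue (`hη1`) and for the index i
  -- (`eq_of_pow_eq_pow_pow`).
  cases k with
  | Tpp_one => cases l with
    | Tpp_root h => exact absurd (trivial_Tppq_of_iso hpq.ne e.symm).1 (hω1 h)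
    | _ => first | rfl | simp [FineIndex.family] at hfam
  | Tpp_root h => cases l with
    | Tpp_one => exact absurd (trivial_Tppq_of_iso hpq.ne e).1 (hω1 h)
    | _ => first | rfl | simp [FineIndex.family] at hfam
  | Tp2_one => cases l with
    | Tp2_root h => exact absurd ((hT2 e).1.1 rfl) (hr1 (hω1 h))
    | Tp2_root2 h => exact absurd ((hT2 e).2.1 (one_pow p)) (hw h)
    | _ => first | rfl | simp [FineIndex.family] at hfam
  | Tp2_root h => cases l with
    | Tp2_one => exact absurd ((hT2 e).1.2 rfl) (hr1 (hω1 h))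
    | Tp2_root2 h => exact absurd ((hT2 e).2.1 (hr ω)) (hw h)
    | _ => first | rfl | simp [FineIndex.family] at hfam
  | Tp2_root2 h => cases l with
    | Tp2_one => exact absurd ((hT2 e).2.2 (one_pow p)) (hw h)
    | Tp2_root _ => exact absurd ((hT2 e).2.2 (hr ω)) (hw h)
    | _ => first | rfl | simp [FineIndex.family] at hfam
  | Bpp_one => cases l with
    | Bpp_one_root h => exact absurd ((hB e.symm rfl).2 rfl) (hω1 h)
    | Bpp_root_one h => exact absurd (hB e.symm rfl).1 (hω1 h)
    | Bpp_nonresidue h => exact absurd (hB e.symm rfl).1 (hωη h)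
    | _ => first | rfl | simp [FineIndex.family] at hfam
  | Bpp_one_root h => cases l with
    | Bpp_one => exact absurd ((hB e rfl).2 rfl) (hω1 h)
    | Bpp_root_one h => exact absurd (hB e.symm rfl).1 (hω1 h)
    | Bpp_nonresidue h => exact absurd (hB e.symm rfl).1 (hωη h)
    | _ => first | rfl | simp [FineIndex.family] at hfam
  | Bpp_root_one h => cases l with
    | Bpp_one => exact absurd (hB e rfl).1 (hω1 h)
    | Bpp_one_root _ => exact absurd (hB e rfl).1 (hω1 h)
    | Bpp_nonresidue _ =>
      obtain ⟨t, ht, -⟩ := exists_pow_of_Bppq_iso hp hpq.ne e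
      exact (hη1 h t ht).elim
    | _ => first | rfl | simp [FineIndex.family] at hfam
  | Bpp_nonresidue h => cases l with
    | Bpp_one => exact absurd (hB e rfl).1 (hωη h)
    | Bpp_one_root _ => exact absurd (hB e rfl).1 (hωη h)
    | Bpp_root_one _ =>
      obtain ⟨t, ht, -⟩ := exists_pow_of_Bppq_iso hp hpq.ne e.symm
      exact (hη1 h t ht).elim
    | _ => first | rfl | simp [FineIndex.family] at hfam
  | Bp2_one => cases l with
    | Bp2_root h i => exact absurd ((hB2 e).1.1 rfl) (hr1 (hi1 h i.2))
    | Bp2_root2 h i => exact absurd ((hB2 e).2.1 (one_pow p)) (hi2 h (not_dvd_of_mem_Icc i.2))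
    | _ => first | rfl | simp [FineIndex.family] at hfam
  | Bp2_root h i => cases l with
    | Bp2_one => exact absurd ((hB2 e).1.2 rfl) (hr1 (hi1 h i.2))
    | Bp2_root _ j =>
      obtain ⟨k, hk, hij⟩ := exists_pow_of_Bp2q_iso hp hpq.ne e
      rw [← map_pow] at hij
      have := eq_of_pow_eq_pow_pow (hω h) dvd_rfl i.2 j.2 hk (rootIncl_injective hij)
      rw [Subtype.ext this]
    | Bp2_root2 h i => exact absurd ((hB2 e).2.1 (hr _)) (hi2 h (not_dvd_of_mem_Icc i.2))
    | _ => simp [FineIndex.family] at hfam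
  | Bp2_root2 h i => cases l with
    | Bp2_one => exact absurd ((hB2 e).2.2 (one_pow p)) (hi2 h (not_dvd_of_mem_Icc i.2))
    | Bp2_root _ _ => exact absurd ((hB2 e).2.2 (hr _)) (hi2 h (not_dvd_of_mem_Icc i.2))
    | Bp2_root2 _ j =>
      obtain ⟨k, hk, hij⟩ := exists_pow_of_Bp2q_iso hp hpq.ne e
      have := eq_of_pow_eq_pow_pow (hω' h) (dvd_pow_self p two_ne_zero) i.2 j.2 hk hij
      rw [Subtype.ext this]
    | _ => simp [FineIndex.family] at hfam

end LeftBrace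

theorem mainTheorem3 (p q : ℕ) [Fact p.Prime] [Fact q.Prime] (hp : 2 < p) (hpq : p < q)
    (ω : rootsOfUnity p (ZMod q)) (hω : p ∣ q - 1 → IsPrimitiveRoot ω p)
    (ω' : rootsOfUnity (p ^ 2) (ZMod q)) (hω' : p ^ 2 ∣ q - 1 → IsPrimitiveRoot ω' (p ^ 2))
    (η : ZMod p) (hη : ¬ IsSquare η)
    {A : Type*} [AddCommGroup A] (S : LeftBrace A) (hA : Nat.card A = p ^ 2 * q) :
    ∃! k : FineIndex p q, Nonempty (S.Iso (fineList p q hp ω ω' η k).brace) := by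
  obtain ⟨k, ⟨i⟩⟩ := S.exists_fineList (ω := ω) (ω' := ω') hp hpq hω hω' hη hA
  exact ⟨k, ⟨i⟩, fun l ⟨j⟩ => LeftBrace.fineList_injective hp hpq hω hω' hη (j.symm.trans i)⟩
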